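/- Let $P(m)=b_dm^d+\dots+b_1m+b_0$ be a polynomial with integer coefficients, of degree $d\ge 1$ and with $b_d>0$. For an integer $t\ge 1$ put $K_t=\frac1t\sum_{m=1}^t 1_{\{P(m)\}}$ on $\mathbb Z$, so that $\widehat{K_t}(\alpha)=\frac1t\sum_{m=1}^t e^{-2\pi i\alpha P(m)}$ for $\alpha\in\mathbb T=\mathbb R/\mathbb Z$. For an integer $n\ge 0$ put $C_t=K_t-K_{2^n}$. For an integer $s\ge 0$ let $\mathcal R_s$ be the set of reduced fractions $a/q$ with $0\le a<q$ and $2^s\le q<2^{s+1}$ (so $\mathcal R_0=\{0/1\}$). With $\{x\}$ the fractional part of $x$, let $D_{a/q}(\alpha)=|\{b_d\alpha\}-a/q|$ if $q\ge 2$; since $0$ and $1$ are identified, let $D_{0/1}(\alpha)$ be the distance from $b_d\alpha$ to the nearest integer. Fix $0<\delta<\frac14$. For $a/q\in\mathcal R_s$ with $s\le n\delta$, the major arc at $a/q$ is $\mathfrak M_n(a/q)=\{\alpha\in\mathbb T: D_{a/q}(\alpha)<2^{-n(d-\delta)}\}$; the set of minor arcs is $\mathfrak m_n=\mathbb T\setminus\bigcup_{s\le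 n\delta}\bigcup_{a/q\in\mathcal R_s}\mathfrak M_n(a/q)$. Then there are an absolute constant $A>0$ and constants $\nu>0$ and $C>0$, depending only on $P$ and $\delta$, such that for all integers $n\ge 0$ and $t$ with $2^n\le t\le 2^{n+1}$: 1. for every $\alpha\in\mathbb T$, $|\widehat{C_t-C_{t+1}}(\alpha)|=|\widehat{K_t-K_{t+1}}(\alpha)|\le A\,2^{-n}$ (in fact $\widehat{C_t-C_{t+1}}(\alpha)=\widehat{K_t-K_{t+1}}(\alpha)$); 2. for every $\alpha\in\mathfrak m_n$, $|\widehat{C_t}(\alpha)|\le C\,2^{-n\nu}$; 3. for every $s\le n\delta$, every $a/q\in\mathcal R_s$ and every $\alpha\in\mathfrak M_n(a/q)$, $$|\widehat{C_t}(\alpha)|\le C\,2^{-\nu s}\Big(\min\Big\{2^nD_{a/q}(\alpha)^{1/d},\ \frac{1}{2^nD_{a/q}(\alpha)^{1/d}}\Big\}+2^{-n/2}\Big),$$ where the minimum is read as $0$ if $D_{a/q}(\alpha)=0$. -/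

import Mathlib

open Polynomial

namespace PolyMeans

noncomputable section

/-- The Fourier transform `∑ x, f x e(-x α)` of a finitely supported function `f` on `ℤ`,
with `e(u) = exp (2 π i u)`. It is `1`-periodic in `α`, so a frequency in `ℝ / ℤ` is
represented here by any of its real representatives. -/
def fourierZ (f : ℤ →₀ ℂ) (α : ℝ) : ℂ :=
  f.sum fun x c => c * Complex.exp (-(2 * Real.pi * Complex.I * (x : ℂ) * (α : ℂ)))

/-- The averaging kernel `K_t = (1 / t) ∑_{m = 1}^{t} 1_{P(m)}` on `ℤ`. -/
def kernelK (P : ℤ[X]) (t : ℕ) : ℤ →₀ ℂ :=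
  (1 / (t : ℂ)) • ∑ m ∈ Finset.Icc 1 t, Finsupp.single (P.eval (m : ℤ)) (1 : ℂ)

/-- The difference `C_t = K_t - K_{2^n}` (used for `t` between `2^n` and `2^{n+1}`). -/
def kernelC (P : ℤ[X]) (n t : ℕ) : ℤ →₀ ℂ :=
  kernelK P t - kernelK P (2 ^ n)

/-- The reduced fractions `a / q` in `ℝ / ℤ` with `2^s ≤ q < 2^{s+1}`, as pairs `(a, q)`
with `0 ≤ a < q`. For `s = 0` the only one is `0 / 1`. -/
def ratShell (s : ℕ) : Set (ℕ × ℕ) :=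
  {r | r.1 < r.2 ∧ Nat.Coprime r.1 r.2 ∧ 2 ^ s ≤ r.2 ∧ r.2 < 2 ^ (s + 1)}

/-- The distance `|{b_d α} - a / q|`, where `b_d` is the leading coefficient of `P`. Since
`0` and `1` are identified, for the fraction `0 / 1` it is the distance from `b_d α` to the
nearest integer. -/
def arcDist (P : ℤ[X]) (a q : ℕ) (α : ℝ) : ℝ :=
  if q = 1 then |(P.leadingCoeff : ℝ) * α - round ((P.leadingCoeff : ℝ) * α)|
  else |Int.fract ((P.leadingCoeff : ℝ) * α) - (a : ℝ) / (q : ℝ)|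

/-- The major arc at scale `n` around `a / q`. -/
def majorArc (P : ℤ[X]) (δ : ℝ) (n a q : ℕ) : Set ℝ :=
  {α | arcDist P a q α < (2 : ℝ) ^ (-((n : ℝ) * ((P.natDegree : ℝ) - δ)))}

/-- The union of the major arcs at scale `n` around all fractions with `q ≈ 2^s`, `s ≤ n δ`. -/
def majorArcs (P : ℤ[X]) (δ : ℝ) (n : ℕ) : Set ℝ :=
  {α | ∃ s : ℕ, (s : ℝ) ≤ (n : ℝ) * δ ∧ ∃ a q : ℕ, (a, q) ∈ ratShell s ∧ α ∈ majorArc P δ n a q}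

/-- The minor arcs at scale `n`. -/
def minorArcs (P : ℤ[X]) (δ : ℝ) (n : ℕ) : Set ℝ :=
  (majorArcs P δ n)ᶜ

end

end PolyMeans

/-! Up to conjugation, the transform of `kernelK P t` at α is the mean of e(α P(m)) over 1 ≤ m ≤ t
(`fourierZ_kernelK`), so the theorem concerns Weyl sums. The first estimate is elementary: one more
term moves a mean of t unimodular numbers by O(1/t).

On a minor arc, Dirichlet's theorem gives a reduced fraction a/q close to b_d α with q ≤ 2^(n(d-δ)).
A denominator of size below 2^(nδ) would put α on a major arc, so q is large, and Weyl's inequality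
(`weyl_inequality`) saves a power of 2^n for K_t and K_{2^n} separately.

On a major arc, α = A/Q + γ with Q = b_d q and |γ| = D/b_d. The phase is a Q-periodic factor times a
slowly varying one, so by summation by parts (`norm_expMean_sub_mul_le`) the mean at α is G times
the mean at γ, up to O(2^(-n(1-2δ))), where G is the complete normalised sum mod Q. As δ < 1/4, that
error beats 2^(-n/2), and the surplus pays for the factor 2^(-νs) because s ≤ nδ. Weyl's inequality
also shows that G decays like a power of q (`exists_gauss_bound`). The minimum comes from the means
at γ (`exists_mean_difference_bound`): both are within O(2^(nd)|γ|) of 1, and both are O(1/(2^n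
|γ|^(1/d))) by Kusmin–Landau. Only for small γ is the cancellation between K_t and K_{2^n} needed.
-/

namespace PolyMeans

/-! ### The additive character and the distance to the nearest integer -/

/-- The additive character `e(x) = exp (2 π i x)`. -/
noncomputable def e (x : ℝ) : ℂ := Complex.exp (Complex.I * ((2 * Real.pi * x : ℝ) : ℂ))

/-- The distance from `x` to the nearest integer. -/
noncomputable def nd (x : ℝ) : ℝ := |x - round x|

lemma e_add (x y : ℝ) : e (x + y) = e x * e y := by
  unfold e; rw [← Complex.exp_add]; congr 1; push_cast; ring

lemma norm_e (x : ℝ) : ‖e x‖ = 1 := by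
  unfold e; rw [mul_comm]; exact Complex.norm_exp_ofReal_mul_I _

lemma e_ne_zero (x : ℝ) : e x ≠ 0 := by
  rw [← norm_ne_zero_iff, norm_e]; exact one_ne_zero

lemma e_sub (x y : ℝ) : e (x - y) = e x / e y := by
  rw [eq_div_iff (e_ne_zero y), ← e_add, sub_add_cancel]

lemma e_neg (x : ℝ) : e (-x) = (starRingEnd ℂ) (e x) := by
  unfold e; rw [← Complex.exp_conj]; congr 1
  rw [map_mul, Complex.conj_I, Complex.conj_ofReal]; push_cast; ring

lemma e_int (z : ℤ) : e z = 1 := by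
  unfold e
  rw [Complex.exp_eq_one_iff]
  exact ⟨z, by push_cast; ring⟩

lemma e_add_int (x : ℝ) (z : ℤ) : e (x + z) = e x := by rw [e_add, e_int, mul_one]

lemma norm_e_sub_one_le (x : ℝ) : ‖e x - 1‖ ≤ 2 * Real.pi * |x| := by
  have h := @Real.norm_exp_I_mul_ofReal_sub_one_le (2 * Real.pi * x)
  rw [Real.norm_eq_abs, abs_mul, abs_of_pos Real.two_pi_pos] at h
  exact h

lemma norm_e_sub_e_le (x y : ℝ) : ‖e x - e y‖ ≤ 2 * Real.pi * |x - y| := by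
  have h : e x - e y = e y * (e (x - y) - 1) := by
    rw [e_sub]; field_simp [e_ne_zero y]
  rw [h, norm_mul, norm_e, one_mul]
  exact norm_e_sub_one_le _

lemma four_mul_abs_le_norm_e_sub_one {x : ℝ} (hx : |x| ≤ 1 / 2) : 4 * |x| ≤ ‖e x - 1‖ := by
  unfold e
  rw [Complex.norm_exp_I_mul_ofReal_sub_one, Real.norm_eq_abs, abs_mul, abs_two]
  have h := Real.mul_abs_le_abs_sin (x := 2 * Real.pi * x / 2) (by
    rw [show 2 * Real.pi * x / 2 = Real.pi * x by ring, abs_mul, abs_of_pos Real.pi_pos]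
    nlinarith [Real.pi_pos])
  rw [show 2 * Real.pi * x / 2 = Real.pi * x by ring] at h ⊢
  rw [abs_mul, abs_of_pos Real.pi_pos, ← mul_assoc, div_mul_cancel₀ _ Real.pi_pos.ne'] at h
  linarith

lemma nd_nonneg (x : ℝ) : 0 ≤ nd x := abs_nonneg _

lemma four_mul_nd_le_norm_e_sub_one (x : ℝ) : 4 * nd x ≤ ‖e x - 1‖ := by
  have h := four_mul_abs_le_norm_e_sub_one (abs_sub_round x)
  have h2 : e (x - round x) = e x := by
    have := e_add_int (x - round x) (round x)
    rw [sub_add_cancel] at this; exact this.symm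
  rwa [h2] at h

/-! ### The divisor bound -/

lemma add_one_le_two_pow (v : ℕ) : v + 1 ≤ 2 ^ v := Nat.lt_two_pow_self

/-- The divisor bound. -/
lemma exists_card_divisors_le {ε : ℝ} (hε : 0 < ε) :
    ∃ C : ℝ, 0 < C ∧ ∀ n : ℕ, n ≠ 0 → (n.divisors.card : ℝ) ≤ C * (n : ℝ) ^ ε := by
  -- Primes p ≥ M satisfy p^ε ≥ 2, so v + 1 ≤ 2^v ≤ p^(εv) costs nothing. Each of the fewer than M
  -- smaller primes costs a factor B, chosen so that B(1 + vε log 2) ≥ v + 1 for every v.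
  set M : ℕ := ⌈(2 : ℝ) ^ (1 / ε)⌉₊ with hM
  set B : ℝ := 1 / (ε * Real.log 2) + 1 with hB
  have hl : 0 < ε * Real.log 2 := mul_pos hε (Real.log_pos (by norm_num))
  have hB1 : 1 ≤ B := by rw [hB]; linarith [one_div_pos.2 hl]
  refine ⟨B ^ M, by positivity, fun n hn => ?_⟩
  have hfac : (n : ℝ) ^ ε = ∏ p ∈ n.primeFactors, ((p : ℝ) ^ ε) ^ (n.factorization p) := by
    conv_lhs => rw [← Nat.prod_factorization_pow_eq_self hn]
    rw [Finsupp.prod, Nat.support_factorization]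
    push_cast
    rw [← Real.finsetProd_rpow _ _ (fun i _ => by positivity)]
    refine Finset.prod_congr rfl fun p _ => ?_
    rw [← Real.rpow_natCast, ← Real.rpow_natCast, ← Real.rpow_mul (by positivity),
      ← Real.rpow_mul (by positivity), mul_comm]
  have hterm : ∀ p ∈ n.primeFactors, ((n.factorization p + 1 : ℕ) : ℝ) ≤
      (if p < M then B else 1) * ((p : ℝ) ^ ε) ^ (n.factorization p) := by
    intro p hp
    have hp2 : (2 : ℝ) ≤ p := by exact_mod_cast (Nat.prime_of_mem_primeFactors hp).two_le
    set v := n.factorization p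
    split_ifs with h
    · have h1 : 1 + ε * Real.log 2 ≤ (p : ℝ) ^ ε := by
        calc 1 + ε * Real.log 2 ≤ Real.exp (ε * Real.log 2) := by
              linarith [Real.add_one_le_exp (ε * Real.log 2)]
          _ = (2 : ℝ) ^ ε := by rw [Real.rpow_def_of_pos (by norm_num), mul_comm]
          _ ≤ _ := Real.rpow_le_rpow (by norm_num) hp2 hε.le
      have h2 : 1 + v * (ε * Real.log 2) ≤ ((p : ℝ) ^ ε) ^ v :=
        (one_add_mul_le_pow (by linarith) v).trans (pow_le_pow_left₀ (by linarith) h1 v)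
      have h3 : B * (1 + v * (ε * Real.log 2)) = B + v * (1 + ε * Real.log 2) := by
        rw [hB]; field_simp
      have h4 : B * (1 + v * (ε * Real.log 2)) ≤ B * ((p : ℝ) ^ ε) ^ v := by gcongr
      rw [h3] at h4
      push_cast
      nlinarith [mul_nonneg (Nat.cast_nonneg (α := ℝ) v) hl.le]
    · rw [one_mul]
      have h1 : (2 : ℝ) ≤ (p : ℝ) ^ ε := by
        have h5 : (2 : ℝ) ^ (1 / ε) ≤ p := (Nat.le_ceil _).trans (by exact_mod_cast not_lt.1 h)
        calc (2 : ℝ) = ((2 : ℝ) ^ (1 / ε)) ^ ε := by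
              rw [← Real.rpow_mul (by norm_num), one_div_mul_cancel hε.ne', Real.rpow_one]
          _ ≤ _ := Real.rpow_le_rpow (by positivity) h5 hε.le
      calc ((v + 1 : ℕ) : ℝ) ≤ (2 : ℝ) ^ v := by exact_mod_cast add_one_le_two_pow v
        _ ≤ _ := pow_le_pow_left₀ (by norm_num) h1 v
  rw [Nat.card_divisors hn, hfac]
  push_cast
  calc ∏ p ∈ n.primeFactors, ((n.factorization p : ℝ) + 1)
      ≤ ∏ p ∈ n.primeFactors, ((if p < M then B else 1) * ((p : ℝ) ^ ε) ^ (n.factorization p)) :=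
        Finset.prod_le_prod (fun _ _ => by positivity) (fun p hp => by exact_mod_cast hterm p hp)
    _ = (∏ p ∈ n.primeFactors, (if p < M then B else 1)) *
          ∏ p ∈ n.primeFactors, ((p : ℝ) ^ ε) ^ (n.factorization p) := Finset.prod_mul_distrib
    _ ≤ _ := by
        gcongr
        rw [Finset.prod_ite, Finset.prod_const, Finset.prod_const_one, mul_one]
        refine pow_le_pow_right₀ hB1 ?_
        calc _ ≤ (Finset.range M).card := Finset.card_le_card fun p hp => by
              simpa using (Finset.mem_filter.1 hp).2
          _ = M := Finset.card_range M

/-! ### Geometric sums -/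

/-- The function `2 N / (1 + N ‖x‖)`, which is comparable to `min (N, 1 / ‖x‖)`. -/
noncomputable def fejerBound (N : ℕ) (x : ℝ) : ℝ := 2 * N / (1 + N * nd x)

lemma one_add_mul_nd_pos (N : ℕ) (x : ℝ) : 0 < 1 + N * nd x := by
  have := mul_nonneg (Nat.cast_nonneg (α := ℝ) N) (nd_nonneg x); linarith

lemma fejerBound_nonneg (N : ℕ) (x : ℝ) : 0 ≤ fejerBound N x :=
  div_nonneg (by positivity) (one_add_mul_nd_pos N x).le

lemma fejerBound_le_two_mul (N : ℕ) (x : ℝ) : fejerBound N x ≤ 2 * N :=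
  div_le_self (by positivity) (by
    have := mul_nonneg (Nat.cast_nonneg (α := ℝ) N) (nd_nonneg x); linarith)

lemma fejerBound_le_div {N : ℕ} {x y : ℝ} (hy : 0 < y) (h : y ≤ nd x) :
    fejerBound N x ≤ 2 / y := by
  unfold fejerBound
  rw [div_le_div_iff₀ (one_add_mul_nd_pos N x) hy]
  have := mul_le_mul_of_nonneg_left h (Nat.cast_nonneg (α := ℝ) N)
  linarith

lemma norm_sum_e_le (L : ℕ) (f : ℕ → ℝ) : ‖∑ m ∈ Finset.range L, e (f m)‖ ≤ L := by
  refine (norm_sum_le _ _).trans ?_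
  simp [norm_e]

/-- Multiplying by e(θ) - 1 telescopes the sum, which gives ‖S‖ · nd θ ≤ 1/2. Adding N times this to
the trivial bound ‖S‖ ≤ N yields one smooth bound, uniform in c and in L ≤ N. -/
lemma norm_geom_sum_e_le {L N : ℕ} (hL : L ≤ N) (c θ : ℝ) :
    ‖∑ m ∈ Finset.range L, e (c + θ * m)‖ ≤ fejerBound N θ := by
  set S := ∑ m ∈ Finset.range L, e (c + θ * m) with hS
  have h1 : ‖S‖ ≤ N := (norm_sum_e_le L _).trans (by exact_mod_cast hL)
  have h2 : S * (e θ - 1) = e (c + θ * L) - e c := by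
    rw [hS, Finset.sum_mul]
    have := Finset.sum_range_sub (fun m : ℕ => e (c + θ * m)) L
    simp only [Nat.cast_zero, mul_zero, add_zero] at this
    rw [← this]
    refine Finset.sum_congr rfl fun m _ => ?_
    rw [mul_sub, mul_one, ← e_add]
    congr 2; push_cast; ring
  have h3 : ‖S‖ * ‖e θ - 1‖ ≤ 2 := by
    rw [← norm_mul, h2]
    refine (norm_sub_le _ _).trans ?_
    rw [norm_e, norm_e]; norm_num
  have h4 := mul_le_mul_of_nonneg_left (four_mul_nd_le_norm_e_sub_one θ) (norm_nonneg S)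
  unfold fejerBound
  rw [le_div_iff₀ (one_add_mul_nd_pos N θ)]
  have h5 : ‖S‖ * nd θ ≤ 1 / 2 := by linarith
  have h6 := mul_le_mul_of_nonneg_left h5 (Nat.cast_nonneg (α := ℝ) N)
  nlinarith [Nat.cast_nonneg (α := ℝ) N]

/-! ### Weyl differencing -/

/-- The Weyl–van der Corput differencing inequality. -/
lemma norm_sum_sq_le (a : ℕ → ℂ) (L : ℕ) :
    ‖∑ m ∈ Finset.range L, a m‖ ^ 2 ≤
      2 * ∑ h ∈ Finset.range L,
        ‖∑ m ∈ Finset.range (L - h), a (m + h) * (starRingEnd ℂ) (a m)‖ := by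
  -- Appending a_L to a sum S adds |a_L|² + 2 Re(a_L S̄) on the left and 2|a_L|² + 2 Re(a_L S̄) on
  -- the right. The factor 2 stands for the negative shifts, which are conjugates of the positive
  -- ones.
  have key : ∀ L : ℕ, ‖∑ m ∈ Finset.range L, a m‖ ^ 2 ≤
      2 * (∑ h ∈ Finset.range L,
        ∑ m ∈ Finset.range (L - h), a (m + h) * (starRingEnd ℂ) (a m)).re := by
    intro L
    induction L with
    | zero => simp
    | succ L ih =>
      have h1 : ∑ h ∈ Finset.range (L + 1),
          ∑ m ∈ Finset.range (L + 1 - h), a (m + h) * (starRingEnd ℂ) (a m) =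
          (∑ h ∈ Finset.range L,
            ∑ m ∈ Finset.range (L - h), a (m + h) * (starRingEnd ℂ) (a m)) +
          a L * (starRingEnd ℂ) (∑ m ∈ Finset.range (L + 1), a m) := by
        have h2 : ∀ h ∈ Finset.range (L + 1),
            ∑ m ∈ Finset.range (L + 1 - h), a (m + h) * (starRingEnd ℂ) (a m) =
            (∑ m ∈ Finset.range (L - h), a (m + h) * (starRingEnd ℂ) (a m)) +
              a L * (starRingEnd ℂ) (a (L - h)) := by
          intro h hh
          have hh' : h ≤ L := Nat.lt_succ_iff.1 (Finset.mem_range.1 hh)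
          rw [Nat.sub_add_comm hh', Finset.sum_range_succ, Nat.sub_add_cancel hh']
        rw [Finset.sum_congr rfl h2, Finset.sum_add_distrib, Finset.sum_range_succ]
        simp only [Nat.sub_self, Finset.range_zero, Finset.sum_empty, add_zero]
        rw [← Finset.mul_sum, map_sum]
        congr 2
        have := Finset.sum_range_reflect (fun m => (starRingEnd ℂ) (a m)) (L + 1)
        simpa using this
      rw [h1, Complex.add_re, mul_add, Finset.sum_range_succ]
      set S := ∑ m ∈ Finset.range L, a m
      have h3 : ‖S + a L‖ ^ 2 = ‖S‖ ^ 2 + ‖a L‖ ^ 2 + 2 * (a L * (starRingEnd ℂ) S).re := by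
        rw [Complex.sq_norm, Complex.sq_norm, Complex.sq_norm, Complex.normSq_add]
        simp [Complex.mul_re]; ring
      have h4 : (a L * (starRingEnd ℂ) (S + a L)).re =
          (a L * (starRingEnd ℂ) S).re + ‖a L‖ ^ 2 := by
        rw [map_add, mul_add, Complex.add_re, Complex.mul_conj, Complex.sq_norm,
          Complex.ofReal_re]
      rw [h3, h4]
      nlinarith [sq_nonneg ‖a L‖]
  refine (key L).trans ?_
  gcongr
  exact (Complex.re_le_norm _).trans (norm_sum_le _ _)

/-- The j-th Hasse derivative of a polynomial of degree at most j + 1 is linear. Iterated, this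
produces the coefficient (k+1)! f_{k+1} h₁⋯h_k of the final linear phase. Applied with j beyond the
degree bound, it also shows that differencing lowers the degree. -/
lemma coeff_taylor_sub {f : ℝ[X]} {j : ℕ} (hf : f.natDegree ≤ j + 1) (r : ℝ) :
    (taylor r f - f).coeff j = (j + 1) * f.coeff (j + 1) * r := by
  have h : hasseDeriv j f = C (f.coeff j) + C ((j + 1) * f.coeff (j + 1)) * X := by
    ext i
    rw [hasseDeriv_coeff]
    match i with
    | 0 => simp
    | 1 => simp [add_comm 1 j, coeff_C]
    | i + 2 =>
      rw [coeff_eq_zero_of_natDegree_lt (by omega)]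
      simp [coeff_one]
  rw [coeff_sub, taylor_coeff, h]
  simp

lemma natDegree_taylor_sub_le {f : ℝ[X]} {k : ℕ} (hf : f.natDegree ≤ k + 1) (r : ℝ) :
    (taylor r f - f).natDegree ≤ k := by
  rw [natDegree_le_iff_coeff_eq_zero]
  intro j hj
  rw [coeff_taylor_sub (by omega), coeff_eq_zero_of_natDegree_lt (n := j + 1) (by omega)]
  simp

/-- The sum of `F (h₁ ⋯ h_k)` over `0 ≤ h₁, …, h_k < N`. -/
noncomputable def prodSum (N : ℕ) : ℕ → (ℕ → ℝ) → ℝ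
  | 0, F => F 1
  | k + 1, F => ∑ h ∈ Finset.range N, prodSum N k fun r => F (h * r)

/-- Weyl differencing of a polynomial exponential sum down to linear phases. -/
lemma weyl_differencing (N : ℕ) (k : ℕ) :
    ∀ (f : ℝ[X]) (L : ℕ), f.natDegree ≤ k + 1 → L ≤ N →
      ‖∑ m ∈ Finset.range L, e (f.eval (m : ℝ))‖ ^ (2 ^ k) * (N : ℝ) ^ (k + 1) ≤
        2 ^ (2 ^ k) * (N : ℝ) ^ (2 ^ k) *
          prodSum N k fun r => fejerBound N ((k + 1).factorial * f.coeff (k + 1) * r) := by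
  induction k with
  | zero =>
    intro f L hf hL
    have h : ∀ m : ℕ, f.eval (m : ℝ) = f.coeff 0 + f.coeff 1 * m := by
      intro m
      conv_lhs => rw [eq_X_add_C_of_natDegree_le_one hf]
      simp [add_comm]
    simp only [h, prodSum]
    have h2 := norm_geom_sum_e_le hL (f.coeff 0) (f.coeff 1)
    simp only [pow_zero, pow_one, zero_add, Nat.factorial_one, Nat.cast_one, one_mul, mul_one]
    have h3 := fejerBound_nonneg N (f.coeff 1)
    nlinarith [mul_le_mul_of_nonneg_left h2 (Nat.cast_nonneg (α := ℝ) N),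
      mul_nonneg (Nat.cast_nonneg (α := ℝ) N) h3]
  | succ k ih =>
    intro f L hf hL
    set S := ∑ m ∈ Finset.range L, e (f.eval (m : ℝ)) with hS
    set T : ℕ → ℂ := fun h => ∑ m ∈ Finset.range (L - h),
      e ((taylor (h : ℝ) f - f).eval (m : ℝ)) with hT
    have h1 : ‖S‖ ^ 2 ≤ 2 * ∑ h ∈ Finset.range N, ‖T h‖ := by
      refine (norm_sum_sq_le _ L).trans ?_
      gcongr 2 * ?_
      have h2 : ∀ h, ∑ m ∈ Finset.range (L - h), e (f.eval ((m + h : ℕ) : ℝ)) *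
          (starRingEnd ℂ) (e (f.eval (m : ℝ))) = T h := by
        intro h
        refine Finset.sum_congr rfl fun m _ => ?_
        rw [← e_neg, ← e_add, eval_sub, taylor_eval]
        push_cast; rw [sub_eq_add_neg]
      simp only [h2]
      exact Finset.sum_le_sum_of_subset_of_nonneg (Finset.range_mono hL)
        (fun _ _ _ => norm_nonneg _)
    rcases Nat.eq_zero_or_pos N with rfl | hN
    · simp
    have hN' : (0 : ℝ) < N := by exact_mod_cast hN
    -- The power mean inequality, multiplied by N so that no exponent 2^k - 1 occurs. The factor
    -- N^(k+1) in the statement has the same purpose.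
    have h2 : (∑ h ∈ Finset.range N, ‖T h‖) ^ (2 ^ k) * N ≤
        (N : ℝ) ^ (2 ^ k) * ∑ h ∈ Finset.range N, ‖T h‖ ^ (2 ^ k) := by
      obtain ⟨p, hp⟩ : ∃ p, 2 ^ k = p + 1 := ⟨2 ^ k - 1, by
        have := Nat.two_pow_pos k; omega⟩
      have h := pow_sum_le_card_mul_sum_pow (s := Finset.range N) (f := fun h => ‖T h‖)
        (fun _ _ => norm_nonneg _) p
      rw [Finset.card_range] at h
      rw [hp, pow_succ (N : ℝ), mul_right_comm]
      gcongr
    have h3 : ‖S‖ ^ (2 ^ (k + 1)) ≤ 2 ^ (2 ^ k) * (∑ h ∈ Finset.range N, ‖T h‖) ^ (2 ^ k) := by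
      rw [pow_succ' 2 k, pow_mul, ← mul_pow]
      gcongr
    have h4 : ∀ h ∈ Finset.range N, ‖T h‖ ^ (2 ^ k) * (N : ℝ) ^ (k + 1) ≤
        2 ^ (2 ^ k) * (N : ℝ) ^ (2 ^ k) * prodSum N k fun r =>
          fejerBound N ((k + 1 + 1).factorial * f.coeff (k + 1 + 1) * ((h * r : ℕ) : ℝ)) := by
      intro h _
      refine (ih _ (L - h) (natDegree_taylor_sub_le hf h) (by omega)).trans (le_of_eq ?_)
      congr 2
      funext r
      rw [coeff_taylor_sub hf, Nat.factorial_succ (k + 1)]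
      congr 1
      push_cast; ring
    calc ‖S‖ ^ (2 ^ (k + 1)) * (N : ℝ) ^ (k + 1 + 1)
        ≤ (2 ^ (2 ^ k) * (∑ h ∈ Finset.range N, ‖T h‖) ^ (2 ^ k)) * (N : ℝ) ^ (k + 1 + 1) := by
          gcongr
      _ = 2 ^ (2 ^ k) * (N : ℝ) ^ (k + 1) * ((∑ h ∈ Finset.range N, ‖T h‖) ^ (2 ^ k) * N) := by
          ring
      _ ≤ 2 ^ (2 ^ k) * (N : ℝ) ^ (k + 1) *
            ((N : ℝ) ^ (2 ^ k) * ∑ h ∈ Finset.range N, ‖T h‖ ^ (2 ^ k)) := by gcongr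
      _ = 2 ^ (2 ^ k) * (N : ℝ) ^ (2 ^ k) *
            ∑ h ∈ Finset.range N, ‖T h‖ ^ (2 ^ k) * (N : ℝ) ^ (k + 1) := by
          rw [← Finset.sum_mul]; ring
      _ ≤ 2 ^ (2 ^ k) * (N : ℝ) ^ (2 ^ k) * ∑ h ∈ Finset.range N,
            (2 ^ (2 ^ k) * (N : ℝ) ^ (2 ^ k) * prodSum N k fun r =>
          fejerBound N ((k + 1 + 1).factorial * f.coeff (k + 1 + 1) * ((h * r : ℕ) : ℝ))) := by
          exact mul_le_mul_of_nonneg_left (Finset.sum_le_sum h4) (by positivity)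
      _ = _ := by
          rw [← Finset.mul_sum, prodSum, pow_succ 2 k, pow_mul (2 : ℝ), pow_mul (N : ℝ)]
          ring

/-! ### Counting tuples by their product -/

lemma prodSum_const (N k : ℕ) (c : ℝ) : prodSum N k (fun _ => c) = (N : ℝ) ^ k * c := by
  induction k with
  | zero => simp [prodSum]
  | succ k ih => simp [prodSum, ih]; ring

/-- Grouping the tuples by the value of their product. -/
lemma mul_prodSum_le {N : ℕ} (hN : 1 ≤ N) (k : ℕ) :
    ∀ F : ℕ → ℝ, (∀ r, 0 ≤ F r) →
      N * prodSum N k F ≤ k * (N : ℝ) ^ k * F 0 +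
        N * ∑ r ∈ Finset.Icc 1 (N ^ k), (r.divisors.card : ℝ) ^ k * F r := by
  -- At most k N^(k-1) tuples have a zero entry; the factor N avoids that exponent. A product r ≥ 1
  -- arises from at most d(r)^k tuples, since each new entry h divides r and determines the
  -- remaining product.
  induction k with
  | zero => intro F _; simp [prodSum]
  | succ k ih =>
    intro F hF
    obtain ⟨M, rfl⟩ : ∃ M, N = M + 1 := ⟨N - 1, by omega⟩
    set N := M + 1 with hNM
    have hM : (M : ℝ) ≤ N := by rw [hNM]; push_cast; linarith
    have h1 : ∑ h ∈ Finset.Icc 1 M, ∑ r ∈ Finset.Icc 1 (N ^ k),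
        (r.divisors.card : ℝ) ^ k * F (h * r) ≤
        ∑ r ∈ Finset.Icc 1 (N ^ (k + 1)), (r.divisors.card : ℝ) ^ (k + 1) * F r := by
      rw [← Finset.sum_product']
      set s := Finset.Icc 1 M ×ˢ Finset.Icc 1 (N ^ k) with hs
      have hpos : ∀ p ∈ s, p.1 ≠ 0 ∧ p.2 ≠ 0 := by
        intro p hp
        simp only [hs, Finset.mem_product, Finset.mem_Icc] at hp
        omega
      have hmaps : ∀ p ∈ s, p.1 * p.2 ∈ Finset.Icc 1 (N ^ (k + 1)) := by
        intro p hp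
        have h0 := hpos p hp
        simp only [hs, Finset.mem_product, Finset.mem_Icc] at hp ⊢
        refine ⟨Nat.one_le_iff_ne_zero.2 (mul_ne_zero h0.1 h0.2), ?_⟩
        rw [pow_succ']
        exact Nat.mul_le_mul (by omega) hp.2.2
      calc ∑ p ∈ s, (p.2.divisors.card : ℝ) ^ k * F (p.1 * p.2)
          ≤ ∑ p ∈ s, ((p.1 * p.2).divisors.card : ℝ) ^ k * F (p.1 * p.2) := by
            refine Finset.sum_le_sum fun p hp => ?_
            have h0 := hpos p hp
            have := Finset.card_le_card (Nat.divisors_subset_of_dvd (mul_ne_zero h0.1 h0.2)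
              (dvd_mul_left p.2 p.1))
            have := hF (p.1 * p.2)
            gcongr
        _ = ∑ r ∈ Finset.Icc 1 (N ^ (k + 1)), ∑ p ∈ s with p.1 * p.2 = r,
              ((p.1 * p.2).divisors.card : ℝ) ^ k * F (p.1 * p.2) :=
            (Finset.sum_fiberwise_of_maps_to hmaps _).symm
        _ ≤ _ := by
            refine Finset.sum_le_sum fun r hr => ?_
            have hr0 : r ≠ 0 := by have := (Finset.mem_Icc.1 hr).1; omega
            have h2 : ∀ p ∈ s.filter (fun p => p.1 * p.2 = r),
                ((p.1 * p.2).divisors.card : ℝ) ^ k * F (p.1 * p.2) =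
                (r.divisors.card : ℝ) ^ k * F r := by
              intro p hp; rw [(Finset.mem_filter.1 hp).2]
            rw [Finset.sum_congr rfl h2, Finset.sum_const, nsmul_eq_mul, pow_succ',
              mul_assoc (r.divisors.card : ℝ)]
            have h3 : (s.filter (fun p => p.1 * p.2 = r)).card ≤ r.divisors.card := by
              refine Finset.card_le_card_of_injOn Prod.fst (fun p hp => ?_) ?_
              · exact Nat.mem_divisors.2 ⟨⟨p.2, (Finset.mem_filter.1 hp).2.symm⟩, hr0⟩
              · intro p hp p' hp' h
                have e1 := Finset.mem_filter.1 (Finset.mem_coe.1 hp)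
                have e2 := Finset.mem_filter.1 (Finset.mem_coe.1 hp')
                refine Prod.ext h (Nat.eq_of_mul_eq_mul_left
                  (Nat.pos_of_ne_zero (hpos p e1.1).1) ?_)
                rw [e1.2, h, e2.2]
            have := hF r
            gcongr
    have h0 : prodSum N k (fun r => F (0 * r)) = (N : ℝ) ^ k * F 0 := by
      simp only [zero_mul]; exact prodSum_const N k (F 0)
    have h2 : ∀ h : ℕ, N * prodSum N k (fun r => F (h * r)) ≤ k * (N : ℝ) ^ k * F 0 +
        N * ∑ r ∈ Finset.Icc 1 (N ^ k), (r.divisors.card : ℝ) ^ k * F (h * r) := by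
      intro h
      have := ih (fun r => F (h * r)) (fun r => hF _)
      simpa using this
    have hr : Finset.range N = insert 0 (Finset.Icc 1 M) := by
      ext x; simp [hNM]; omega
    rw [prodSum, hr, Finset.sum_insert (by simp), h0, mul_add, Finset.mul_sum]
    have h3 : ∑ h ∈ Finset.Icc 1 M, N * prodSum N k (fun r => F (h * r)) ≤
        M * (k * (N : ℝ) ^ k * F 0) +
        N * ∑ h ∈ Finset.Icc 1 M, ∑ r ∈ Finset.Icc 1 (N ^ k),
          (r.divisors.card : ℝ) ^ k * F (h * r) := by
      refine (Finset.sum_le_sum fun h _ => h2 h).trans (le_of_eq ?_)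
      rw [Finset.sum_add_distrib, Finset.sum_const, Nat.card_Icc, Finset.mul_sum]
      simp
    have h4 : M * (k * (N : ℝ) ^ k * F 0) ≤ N * (k * (N : ℝ) ^ k * F 0) := by
      have := hF 0; gcongr
    have h5 := mul_le_mul_of_nonneg_left h1 (Nat.cast_nonneg (α := ℝ) N)
    have h6 : ((k + 1 : ℕ) : ℝ) * (N : ℝ) ^ (k + 1) * F 0 =
      N * ((N : ℝ) ^ k * F 0) + N * (k * (N : ℝ) ^ k * F 0) := by push_cast; ring
    rw [h6]
    linarith

/-! ### Distribution of multiples of a well approximated number -/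

lemma nd_eq_min_fract (x : ℝ) : nd x = min (Int.fract x) (1 - Int.fract x) :=
  abs_sub_round_eq_min x

lemma sum_harmonic_bound (N : ℕ) {q : ℕ} (hq : 1 ≤ q) :
    ∑ v ∈ Finset.range q, (if v = 0 then 2 * (N : ℝ) else 2 * q / v) ≤
      2 * N + 2 * q * (1 + Real.log q) := by
  obtain ⟨p, rfl⟩ : ∃ p, q = p + 1 := ⟨q - 1, by omega⟩
  rw [Finset.sum_range_succ']
  simp only [Nat.add_eq_zero_iff, one_ne_zero, and_false, if_false, if_true]
  have h := harmonic_le_one_add_log p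
  have h1 : ∑ v ∈ Finset.range p, 2 * ((p + 1 : ℕ) : ℝ) / ((v + 1 : ℕ) : ℝ) =
      2 * ((p + 1 : ℕ) : ℝ) * (harmonic p : ℝ) := by
    rw [harmonic]; push_cast; rw [Finset.mul_sum]
    refine Finset.sum_congr rfl fun v _ => by rw [div_eq_mul_inv]
  rw [h1]
  have h2 : Real.log p ≤ Real.log (p + 1 : ℕ) := by
    rcases Nat.eq_zero_or_pos p with rfl | hp
    · simp
    · exact Real.log_le_log (by exact_mod_cast hp) (by push_cast; linarith)
  have h3 : 2 * ((p + 1 : ℕ) : ℝ) * (harmonic p : ℝ) ≤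
      2 * ((p + 1 : ℕ) : ℝ) * (1 + Real.log (p + 1 : ℕ)) := by gcongr; linarith
  linarith

/-- If x mod 1 lies in the v-th of q equal cells, its distance to the integers is at least v/q or at
least (q-1-v)/q, according to the nearer end. Both terms are added so that summing over v and
reflecting v reduces to one harmonic sum. -/
lemma fejerBound_le_of_floor {N q : ℕ} (hq : 1 ≤ q) {x : ℝ} {v : ℕ}
    (hv : v = ⌊q * Int.fract x⌋₊) :
    v < q ∧ fejerBound N x ≤ (if v = 0 then 2 * (N : ℝ) else 2 * q / v) +
      (if q - 1 - v = 0 then 2 * (N : ℝ) else 2 * q / ((q - 1 - v : ℕ) : ℝ)) := by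
  have hq' : (0 : ℝ) < q := by exact_mod_cast hq
  have hx0 := Int.fract_nonneg x
  have hx1 := Int.fract_lt_one x
  have h1 : (v : ℝ) ≤ q * Int.fract x := hv ▸ Nat.floor_le (by positivity)
  have h2 : q * Int.fract x < v + 1 := by rw [hv]; exact Nat.lt_floor_add_one _
  have hvq : v < q := by
    have : (v : ℝ) < q := by nlinarith
    exact_mod_cast this
  refine ⟨hvq, ?_⟩
  split_ifs with h0 h3 h3
  · have := fejerBound_le_two_mul N x
    have : (0 : ℝ) ≤ N := by positivity
    linarith
  · have := fejerBound_le_two_mul N x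
    have : 0 ≤ 2 * (q : ℝ) / ((q - 1 - v : ℕ) : ℝ) := by positivity
    linarith
  · have := fejerBound_le_two_mul N x
    have : 0 ≤ 2 * (q : ℝ) / (v : ℝ) := by positivity
    linarith
  · have hv0 : (0 : ℝ) < v := by exact_mod_cast Nat.pos_of_ne_zero h0
    have hw0 : (0 : ℝ) < ((q - 1 - v : ℕ) : ℝ) := by exact_mod_cast Nat.pos_of_ne_zero h3
    have hw : ((q - 1 - v : ℕ) : ℝ) = q - 1 - v := by
      rw [Nat.cast_sub (by omega), Nat.cast_sub hq]; simp
    rcases min_choice (Int.fract x) (1 - Int.fract x) with h | h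
    · have h5 : (v : ℝ) / q ≤ nd x := by
        rw [nd_eq_min_fract, h, div_le_iff₀ hq']; linarith
      have := fejerBound_le_div (N := N) (by positivity) h5
      have h6 : 2 / ((v : ℝ) / q) = 2 * q / v := by field_simp
      have : 0 ≤ 2 * (q : ℝ) / ((q - 1 - v : ℕ) : ℝ) := by positivity
      linarith
    · have h5 : ((q - 1 - v : ℕ) : ℝ) / q ≤ nd x := by
        rw [nd_eq_min_fract, h, div_le_iff₀ hq', hw]; linarith
      have := fejerBound_le_div (N := N) (by positivity) h5
      have h6 : 2 / (((q - 1 - v : ℕ) : ℝ) / q) = 2 * q / ((q - 1 - v : ℕ) : ℝ) := by field_simp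
      have : 0 ≤ 2 * (q : ℝ) / (v : ℝ) := by positivity
      linarith

/-- Inside a block of length q, replacing α by a/q moves q times a difference by less than 1. Two
points of one cell therefore satisfy a(u - u₀) ≡ -1, 0 or 1 mod q, and a is invertible mod q. -/
lemma card_fiber_le_three {α : ℝ} {a : ℤ} {q : ℕ} (hq : 1 ≤ q) (hc : IsCoprime a (q : ℤ))
    (hα : |α - a / q| ≤ 1 / (q : ℝ) ^ 2) (r₀ v : ℕ) :
    ((Finset.range q).filter
      (fun u => ⌊(q : ℝ) * Int.fract (α * ((r₀ + u : ℕ) : ℝ))⌋₊ = v)).card ≤ 3 := by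
  set s := (Finset.range q).filter
      (fun u => ⌊(q : ℝ) * Int.fract (α * ((r₀ + u : ℕ) : ℝ))⌋₊ = v) with hs
  have hq' : (0 : ℝ) < q := by exact_mod_cast hq
  rcases s.eq_empty_or_nonempty with h | ⟨u₀, hu₀⟩
  · rw [h]; simp
  set c : ZMod q := (a : ZMod q) * (u₀ : ZMod q) with hcdef
  have hunit : IsUnit (a : ZMod q) := by
    obtain ⟨x, y, hxy⟩ := hc
    refine IsUnit.of_mul_eq_one (x : ZMod q) ?_
    have := congrArg (Int.cast : ℤ → ZMod q) hxy
    push_cast at this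
    rw [ZMod.natCast_self, mul_zero, add_zero] at this
    rw [mul_comm]; exact this
  calc s.card ≤ ({c - 1, c, c + 1} : Finset (ZMod q)).card := by
        refine Finset.card_le_card_of_injOn (fun u : ℕ => (a : ZMod q) * (u : ZMod q)) ?_ ?_
        · intro u hu
          have hu := Finset.mem_filter.1 (Finset.mem_coe.1 hu)
          have hu₀ := Finset.mem_filter.1 hu₀
          have hur := Finset.mem_range.1 hu.1
          have hur₀ := Finset.mem_range.1 hu₀.1
          set x := α * ((r₀ + u : ℕ) : ℝ) with hx
          set x₀ := α * ((r₀ + u₀ : ℕ) : ℝ) with hx₀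
          have hf := Int.fract_nonneg x
          have hf₀ := Int.fract_nonneg x₀
          have h1 : (v : ℝ) ≤ q * Int.fract x := hu.2 ▸ Nat.floor_le (by positivity)
          have h2 : q * Int.fract x < v + 1 := by rw [← hu.2]; exact Nat.lt_floor_add_one _
          have h1' : (v : ℝ) ≤ q * Int.fract x₀ := hu₀.2 ▸ Nat.floor_le (by positivity)
          have h2' : q * Int.fract x₀ < v + 1 := by rw [← hu₀.2]; exact Nat.lt_floor_add_one _
          set z : ℤ := ⌊x⌋ - ⌊x₀⌋ with hz
          have h3 : |q * (x - x₀ - z)| < 1 := by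
            have e1 := Int.fract_add_floor x
            have e2 := Int.fract_add_floor x₀
            have : (q : ℝ) * (x - x₀ - z) = q * Int.fract x - q * Int.fract x₀ := by
              have hzr : (z : ℝ) = ⌊x⌋ - ⌊x₀⌋ := by rw [hz, Int.cast_sub]
              linear_combination (q : ℝ) * e2 - (q : ℝ) * e1 - (q : ℝ) * hzr
            rw [this, abs_lt]; constructor <;> linarith
          have h4 : |q * ((α - a / q) * ((u : ℝ) - u₀))| < 1 := by
            have hd : |(u : ℝ) - u₀| < q := by
              have e1 : (u : ℝ) < q := by exact_mod_cast hur
              have e2 : (u₀ : ℝ) < q := by exact_mod_cast hur₀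
              have e3 : (0 : ℝ) ≤ u := by positivity
              have e4 : (0 : ℝ) ≤ u₀ := by positivity
              rw [abs_lt]; constructor <;> linarith
            rw [abs_mul, abs_mul, abs_of_pos hq']
            calc (q : ℝ) * (|α - a / q| * |(u : ℝ) - u₀|)
                ≤ q * (1 / (q : ℝ) ^ 2 * |(u : ℝ) - u₀|) := by gcongr
              _ = |(u : ℝ) - u₀| / q := by field_simp
              _ < 1 := by rw [div_lt_one hq']; exact hd
          have h5 : |((a * ((u : ℤ) - u₀) - q * z : ℤ) : ℝ)| < 2 := by
            have : ((a * ((u : ℤ) - u₀) - q * z : ℤ) : ℝ) =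
                q * (x - x₀ - z) - q * ((α - a / q) * ((u : ℝ) - u₀)) := by
              rw [hx, hx₀]; push_cast; field_simp; ring
            rw [this]
            refine (abs_sub _ _).trans_lt ?_
            linarith
          have h6 : |a * ((u : ℤ) - u₀) - q * z| < 2 := by exact_mod_cast h5
          set w := a * ((u : ℤ) - u₀) - q * z with hw
          have h7 : (a : ZMod q) * (u : ZMod q) = c + (w : ZMod q) := by
            rw [hw, hcdef]; push_cast; rw [ZMod.natCast_self]; ring
          rw [abs_lt] at h6
          have h8 : w = -1 ∨ w = 0 ∨ w = 1 := by omega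
          simp only [Finset.coe_insert, Finset.coe_singleton, Set.mem_insert_iff,
            Set.mem_singleton_iff]
          rw [h7]
          rcases h8 with h | h | h <;> rw [h]
          · left; push_cast; ring
          · right; left; push_cast; ring
          · right; right; push_cast; ring
        · intro u hu u' hu' h
          have hur := Finset.mem_range.1 (Finset.mem_filter.1 (Finset.mem_coe.1 hu)).1
          have hur' := Finset.mem_range.1 (Finset.mem_filter.1 (Finset.mem_coe.1 hu')).1
          have := hunit.mul_left_cancel h
          rw [ZMod.natCast_eq_natCast_iff] at this
          exact Nat.ModEq.eq_of_lt_of_lt this hur hur'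
    _ ≤ 3 := Finset.card_le_three

lemma sum_fejerBound_block_le {α : ℝ} {a : ℤ} {q : ℕ} (hq : 1 ≤ q) (hc : IsCoprime a (q : ℤ))
    (hα : |α - a / q| ≤ 1 / (q : ℝ) ^ 2) (N r₀ : ℕ) :
    ∑ u ∈ Finset.range q, fejerBound N (α * ((r₀ + u : ℕ) : ℝ)) ≤
      12 * (N + q * (1 + Real.log q)) := by
  set h : ℕ → ℝ := fun v => if v = 0 then 2 * (N : ℝ) else 2 * q / v with hh
  have hpos : ∀ v, 0 ≤ h v := fun v => by simp only [hh]; split_ifs <;> positivity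
  set g : ℕ → ℕ := fun u => ⌊(q : ℝ) * Int.fract (α * ((r₀ + u : ℕ) : ℝ))⌋₊ with hg
  have hb := fun u : ℕ => fejerBound_le_of_floor (N := N) hq
    (x := α * ((r₀ + u : ℕ) : ℝ)) (v := g u) rfl
  calc ∑ u ∈ Finset.range q, fejerBound N (α * ((r₀ + u : ℕ) : ℝ))
      ≤ ∑ u ∈ Finset.range q, (h (g u) + h (q - 1 - g u)) :=
        Finset.sum_le_sum fun u _ => (hb u).2
    _ = ∑ v ∈ Finset.range q, ∑ u ∈ Finset.range q with g u = v,
          (h (g u) + h (q - 1 - g u)) :=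
        (Finset.sum_fiberwise_of_maps_to (fun u _ => Finset.mem_range.2 (hb u).1) _).symm
    _ ≤ ∑ v ∈ Finset.range q, 3 * (h v + h (q - 1 - v)) := by
        refine Finset.sum_le_sum fun v _ => ?_
        have h2 : ∀ u ∈ (Finset.range q).filter (fun u => g u = v),
            h (g u) + h (q - 1 - g u) = h v + h (q - 1 - v) := by
          intro u hu; rw [(Finset.mem_filter.1 hu).2]
        rw [Finset.sum_congr rfl h2, Finset.sum_const, nsmul_eq_mul]
        have h3 : (((Finset.range q).filter (fun u => g u = v)).card : ℝ) ≤ 3 := by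
          exact_mod_cast card_fiber_le_three hq hc hα r₀ v
        exact mul_le_mul_of_nonneg_right h3 (add_nonneg (hpos _) (hpos _))
    _ = 6 * ∑ v ∈ Finset.range q, h v := by
        rw [← Finset.mul_sum, Finset.sum_add_distrib, Finset.sum_range_reflect h q]; ring
    _ ≤ 6 * (2 * N + 2 * q * (1 + Real.log q)) := by
        gcongr; exact sum_harmonic_bound N hq
    _ = _ := by ring

lemma sum_fejerBound_le {α : ℝ} {a : ℤ} {q : ℕ} (hq : 1 ≤ q) (hc : IsCoprime a (q : ℤ))
    (hα : |α - a / q| ≤ 1 / (q : ℝ) ^ 2) (N R : ℕ) :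
    ∑ r ∈ Finset.Icc 1 R, fejerBound N (α * r) ≤
      ((R : ℝ) / q + 1) * (12 * (N + q * (1 + Real.log q))) := by
  have hq' : (0 : ℝ) < q := by exact_mod_cast hq
  have hlog : 0 ≤ Real.log q := Real.log_natCast_nonneg q
  have key : ∀ j : ℕ, ∑ r ∈ Finset.range (j * q), fejerBound N (α * r) ≤
      j * (12 * (N + q * (1 + Real.log q))) := by
    intro j
    induction j with
    | zero => simp
    | succ j ih =>
      rw [Nat.succ_mul, Finset.sum_range_add]
      have := sum_fejerBound_block_le hq hc hα N (j * q)
      push_cast at this ⊢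
      linarith
  calc ∑ r ∈ Finset.Icc 1 R, fejerBound N (α * r)
      ≤ ∑ r ∈ Finset.range ((R / q + 1) * q), fejerBound N (α * r) := by
        refine Finset.sum_le_sum_of_subset_of_nonneg ?_ (fun _ _ _ => fejerBound_nonneg _ _)
        intro r hr
        have h1 := (Finset.mem_Icc.1 hr).2
        rw [Finset.mem_range]
        have h2 := Nat.div_add_mod R q
        have h3 := Nat.mod_lt R hq
        rw [Nat.add_mul, mul_comm (R / q) q, one_mul]
        omega
    _ ≤ ((R / q + 1 : ℕ) : ℝ) * (12 * (N + q * (1 + Real.log q))) := key _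
    _ ≤ _ := by
        gcongr
        push_cast
        have := @Nat.cast_div_le ℝ _ _ _ R q
        linarith

/-- For q ≥ 2 the reduced fraction a/q is at least 1/q from every integer, and the approximation
error 1/q² is at most half of this. It serves the linear case of Weyl's inequality. -/
lemma le_nd_of_approx {α : ℝ} {a : ℤ} {q : ℕ} (hq : 2 ≤ q) (hc : IsCoprime a (q : ℤ))
    (hα : |α - a / q| ≤ 1 / (q : ℝ) ^ 2) : 1 / (2 * (q : ℝ)) ≤ nd α := by
  have hq2 : (2 : ℝ) ≤ q := by exact_mod_cast hq
  have hq' : (0 : ℝ) < q := by linarith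
  have h0 : a - q * round α ≠ 0 := by
    intro h
    have hd : (q : ℤ) ∣ a := ⟨round α, by linarith⟩
    have h1 := hc.isUnit_of_dvd' hd dvd_rfl
    rw [Int.isUnit_iff] at h1
    omega
  have h1 : (1 : ℝ) ≤ |(a : ℝ) - q * round α| := by
    have := Int.one_le_abs h0
    exact_mod_cast this
  have h2 : 1 / (q : ℝ) ≤ |(a : ℝ) / q - round α| := by
    have : (a : ℝ) / q - round α = (a - q * round α) / q := by field_simp
    rw [this, abs_div, abs_of_pos hq']
    gcongr
  have h3 : |(a : ℝ) / q - round α| ≤ |α - a / q| + nd α := by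
    have h4 := abs_sub (α - round α) (α - a / q)
    have h5 : (a : ℝ) / q - round α = (α - round α) - (α - a / q) := by ring
    rw [h5]; unfold nd; linarith
  have h4 : 1 / (q : ℝ) ^ 2 ≤ 1 / (2 * q) := by
    apply one_div_le_one_div_of_le (by positivity); nlinarith
  have h5 : 1 / (q : ℝ) = 1 / (2 * q) + 1 / (2 * q) := by field_simp; norm_num
  linarith

/-- Differencing leaves a factorial D in front of α, and Dα need not be well approximated with
denominator q. The numbers Dr are instead regarded as some of the integers up to DR, and α keeps its
approximation. -/
lemma sum_fejerBound_mul_le {α : ℝ} {a : ℤ} {q : ℕ} (hq : 1 ≤ q) (hc : IsCoprime a (q : ℤ))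
    (hα : |α - a / q| ≤ 1 / (q : ℝ) ^ 2) (N R : ℕ) {D : ℕ} (hD : 1 ≤ D) :
    ∑ r ∈ Finset.Icc 1 R, fejerBound N (D * α * r) ≤
      ((D * R : ℝ) / q + 1) * (12 * (N + q * (1 + Real.log q))) := by
  have h := sum_fejerBound_le hq hc hα N (D * R)
  push_cast at h
  refine le_trans ?_ h
  have h1 : ∑ r ∈ Finset.Icc 1 R, fejerBound N (D * α * r) =
      ∑ r ∈ (Finset.Icc 1 R).image (fun r => D * r), fejerBound N (α * r) := by
    rw [Finset.sum_image (fun x _ y _ h => Nat.eq_of_mul_eq_mul_left hD h)]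
    refine Finset.sum_congr rfl fun r _ => ?_
    congr 1; push_cast; ring
  rw [h1]
  refine Finset.sum_le_sum_of_subset_of_nonneg ?_ (fun _ _ _ => fejerBound_nonneg _ _)
  intro x hx
  obtain ⟨r, hr, rfl⟩ := Finset.mem_image.1 hx
  have := Finset.mem_Icc.1 hr
  exact Finset.mem_Icc.2 ⟨Nat.mul_pos hD this.1, Nat.mul_le_mul_left D this.2⟩

/-! ### Weyl's inequality -/

/-- **Weyl's inequality**. -/
theorem weyl_inequality (k : ℕ) {ε : ℝ} (hε : 0 < ε) :
    ∃ C : ℝ, 0 < C ∧ ∀ (f : ℝ[X]) (a : ℤ) (q N : ℕ), f.natDegree ≤ k + 1 → 1 ≤ q →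
      IsCoprime a (q : ℤ) → |f.coeff (k + 1) - a / q| ≤ 1 / (q : ℝ) ^ 2 → 1 ≤ N →
      (q : ℝ) ≤ (N : ℝ) ^ (k + 1) →
      ‖∑ m ∈ Finset.range N, e (f.eval (m : ℝ))‖ ^ (2 ^ k) ≤
        C * (N : ℝ) ^ (2 ^ k) * ((N : ℝ) ^ ε * (1 / q + 1 / N + q / (N : ℝ) ^ (k + 1))) := by
  -- A linear phase is a geometric sum. The general argument divides by k² and uses N ≤ N^k, so it
  -- needs k ≥ 1.
  rcases Nat.eq_zero_or_pos k with rfl | hk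
  · refine ⟨4, by norm_num, fun f a q N hf hq hc hα hN _ => ?_⟩
    have hN1 : (1 : ℝ) ≤ N := by exact_mod_cast hN
    have hq1 : (1 : ℝ) ≤ q := by exact_mod_cast hq
    have hNε : 1 ≤ (N : ℝ) ^ ε := Real.one_le_rpow hN1 hε.le
    simp only [pow_zero, pow_one, zero_add] at hα ⊢
    rcases Nat.lt_or_ge q 2 with h | h
    · obtain rfl : q = 1 := by omega
      have h1 := norm_sum_e_le N (fun m => f.eval (m : ℝ))
      have h2 : (1 : ℝ) ≤ (N : ℝ) ^ ε * (1 / (1 : ℕ) + 1 / N + (1 : ℕ) / N) := by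
        have h3 : (1 : ℝ) ≤ 1 / (1 : ℕ) + 1 / N + (1 : ℕ) / N := by
          have : 0 ≤ 1 / (N : ℝ) := by positivity
          push_cast; linarith
        nlinarith
      nlinarith
    · have h1 : ∀ m : ℕ, f.eval (m : ℝ) = f.coeff 0 + f.coeff 1 * m := by
        intro m
        conv_lhs => rw [eq_X_add_C_of_natDegree_le_one hf]
        simp [add_comm]
      simp only [h1]
      have h2 := norm_geom_sum_e_le le_rfl (f.coeff 0) (f.coeff 1) (N := N)
      have h3 := fejerBound_le_div (N := N) (by positivity) (le_nd_of_approx h hc hα)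
      have h4 : 2 / (1 / (2 * (q : ℝ))) = 4 * N * (1 * (q / N)) := by field_simp; norm_num
      rw [h4] at h3
      refine (h2.trans h3).trans ?_
      gcongr
      have : 0 ≤ 1 / (q : ℝ) + 1 / N := by positivity
      linarith
  have hk' : (0 : ℝ) < k := by exact_mod_cast hk
  -- For r ≤ N^k this exponent makes d(r)^k at most C₁^k N^(ε/2). The other N^(ε/2) absorbs 1 + log
  -- q, which is where q ≤ N^(k+1) enters.
  obtain ⟨C₁, hC₁, hdiv⟩ := exists_card_divisors_le (ε := ε / 2 / (k * k)) (by positivity)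
  set C₂ : ℝ := 1 + (k + 1) * (1 / (ε / 2)) with hC₂
  have hC₂' : 0 < C₂ := by positivity
  set D := (k + 1).factorial with hD
  have hD1 : 1 ≤ D := Nat.factorial_pos _
  have hD1' : (1 : ℝ) ≤ D := by exact_mod_cast hD1
  refine ⟨2 ^ 2 ^ k * (2 * k + C₁ ^ k * (24 * C₂ * D)), by positivity,
    fun f a q N hf hq hc hα hN hqN => ?_⟩
  have hN1 : (1 : ℝ) ≤ N := by exact_mod_cast hN
  have hN0 : (0 : ℝ) < N := by linarith
  have hq0 : (0 : ℝ) < q := by exact_mod_cast hq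
  set η := (N : ℝ) ^ (ε / 2) with hη
  have hη1 : 1 ≤ η := Real.one_le_rpow hN1 (by positivity)
  have hηη : (N : ℝ) ^ ε = η * η := by rw [hη, ← Real.rpow_add hN0]; congr 1; ring
  set E := 1 / (q : ℝ) + 1 / N + q / (N : ℝ) ^ (k + 1) with hE
  have hlog : 1 + Real.log q ≤ C₂ * η := by
    have h1 : Real.log q ≤ (k + 1) * Real.log N := by
      have := Real.log_le_log hq0 hqN
      rw [Real.log_pow] at this; exact_mod_cast this
    have h2 := Real.log_le_rpow_div hN0.le (ε := ε / 2) (by positivity)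
    calc 1 + Real.log q ≤ η + (k + 1) * (η / (ε / 2)) := by
          have : (k + 1) * Real.log N ≤ (k + 1) * (η / (ε / 2)) := by gcongr
          linarith
      _ = C₂ * η := by rw [hC₂]; ring
  have hlog0 : 0 ≤ Real.log q := Real.log_natCast_nonneg q
  have hC₂η : 1 ≤ C₂ * η := by linarith
  have hblock : (N : ℝ) + q * (1 + Real.log q) ≤ C₂ * η * (N + q) := by
    have h1 : (q : ℝ) * (1 + Real.log q) ≤ q * (C₂ * η) := by gcongr
    have h2 : (N : ℝ) * 1 ≤ N * (C₂ * η) := by gcongr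
    linarith
  have hE0 : 0 ≤ E := by positivity
  have hNE : (N : ℝ) ^ k ≤ (N : ℝ) ^ (k + 1) * E := by
    have : (N : ℝ) ^ (k + 1) * E = (N : ℝ) ^ (k + 1) / q + N ^ k + q := by
      rw [hE]; field_simp; ring
    rw [this]
    have : 0 ≤ (N : ℝ) ^ (k + 1) / q := by positivity
    linarith
  have hcount : ((D * N ^ k : ℝ) / q + 1) * (N + q) ≤ 2 * D * ((N : ℝ) ^ (k + 1) * E) := by
    have h1 : (N : ℝ) ^ (k + 1) * E = (N : ℝ) ^ (k + 1) / q + N ^ k + q := by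
      rw [hE]; field_simp; ring
    have h2 : ((D * N ^ k : ℝ) / q + 1) * (N + q) =
        D * ((N : ℝ) ^ (k + 1) / q + N ^ k) + (N + q) := by
      field_simp; ring
    have h3 : (N : ℝ) ≤ N ^ k := le_self_pow₀ hN1 hk.ne'
    have h4 : (N : ℝ) + q ≤ D * (N ^ k + q) := by
      have : 1 * ((N : ℝ) + q) ≤ D * (N ^ k + q) := by gcongr
      linarith
    have h5 : 0 ≤ D * ((N : ℝ) ^ (k + 1) / q + q) := by positivity
    rw [h1, h2]
    nlinarith
  have hsum : ∑ r ∈ Finset.Icc 1 (N ^ k), (r.divisors.card : ℝ) ^ k *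
      fejerBound N (D * f.coeff (k + 1) * r) ≤
      C₁ ^ k * (24 * C₂ * D) * ((N : ℝ) ^ ε * ((N : ℝ) ^ (k + 1) * E)) := by
    have h1 : ∀ r ∈ Finset.Icc 1 (N ^ k), (r.divisors.card : ℝ) ^ k ≤ C₁ ^ k * η := by
      intro r hr
      have hr' := Finset.mem_Icc.1 hr
      have h2 := hdiv r (by omega)
      have h3 : (r : ℝ) ≤ (N : ℝ) ^ k := by exact_mod_cast hr'.2
      have h4 : (r : ℝ) ^ (ε / 2 / (k * k)) ≤ ((N : ℝ) ^ k) ^ (ε / 2 / (k * k)) := by gcongr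
      calc (r.divisors.card : ℝ) ^ k ≤ (C₁ * ((N : ℝ) ^ k) ^ (ε / 2 / (k * k))) ^ k := by
            gcongr
            exact h2.trans (by gcongr)
        _ = C₁ ^ k * η := by
            rw [mul_pow, hη, ← Real.rpow_natCast, ← Real.rpow_natCast, ← Real.rpow_natCast,
              ← Real.rpow_mul hN0.le, ← Real.rpow_mul hN0.le]
            congr 2
            field_simp
    calc ∑ r ∈ Finset.Icc 1 (N ^ k), (r.divisors.card : ℝ) ^ k *
          fejerBound N (D * f.coeff (k + 1) * r)
        ≤ ∑ r ∈ Finset.Icc 1 (N ^ k), C₁ ^ k * η * fejerBound N (D * f.coeff (k + 1) * r) :=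
          Finset.sum_le_sum fun r hr =>
            mul_le_mul_of_nonneg_right (h1 r hr) (fejerBound_nonneg _ _)
      _ = C₁ ^ k * η * ∑ r ∈ Finset.Icc 1 (N ^ k), fejerBound N (D * f.coeff (k + 1) * r) := by
          rw [Finset.mul_sum]
      _ ≤ C₁ ^ k * η * (((D * N ^ k : ℝ) / q + 1) * (12 * (N + q * (1 + Real.log q)))) := by
          have := sum_fejerBound_mul_le hq hc hα N (N ^ k) hD1
          push_cast at this
          gcongr
      _ ≤ C₁ ^ k * η * (((D * N ^ k : ℝ) / q + 1) * (12 * (C₂ * η * (N + q)))) := by gcongr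
      _ = C₁ ^ k * η * (12 * C₂ * η) * (((D * N ^ k : ℝ) / q + 1) * (N + q)) := by ring
      _ ≤ C₁ ^ k * η * (12 * C₂ * η) * (2 * D * ((N : ℝ) ^ (k + 1) * E)) := by gcongr
      _ = _ := by rw [hηη]; ring
  have hps := mul_prodSum_le hN k (fun r => fejerBound N (D * f.coeff (k + 1) * r))
    (fun r => fejerBound_nonneg _ _)
  have hps2 : (prodSum N k fun r => fejerBound N (D * f.coeff (k + 1) * r)) ≤
      (2 * k + C₁ ^ k * (24 * C₂ * D)) * ((N : ℝ) ^ ε * ((N : ℝ) ^ (k + 1) * E)) := by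
    refine le_of_mul_le_mul_left (hps.trans ?_) hN0
    have h1 : k * (N : ℝ) ^ k * fejerBound N (D * f.coeff (k + 1) * (0 : ℕ)) ≤
        k * ((N : ℝ) ^ (k + 1) * E) * (2 * N) := by
      exact mul_le_mul (mul_le_mul_of_nonneg_left hNE hk'.le) (fejerBound_le_two_mul _ _)
        (fejerBound_nonneg _ _) (by positivity)
    have h2 := mul_le_mul_of_nonneg_left hsum hN0.le
    have h3 : k * ((N : ℝ) ^ (k + 1) * E) * (2 * N) ≤
        k * ((N : ℝ) ^ ε * ((N : ℝ) ^ (k + 1) * E)) * (2 * N) := by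
      have h4 : 1 ≤ (N : ℝ) ^ ε := Real.one_le_rpow hN1 hε.le
      refine mul_le_mul_of_nonneg_right (mul_le_mul_of_nonneg_left ?_ hk'.le) (by positivity)
      exact le_mul_of_one_le_left (by positivity) h4
    linarith
  have hw := weyl_differencing N k f N hf le_rfl
  have hNk : (0 : ℝ) < (N : ℝ) ^ (k + 1) := by positivity
  refine le_of_mul_le_mul_right (hw.trans ?_) hNk
  calc _ ≤ 2 ^ 2 ^ k * (N : ℝ) ^ 2 ^ k *
        ((2 * k + C₁ ^ k * (24 * C₂ * D)) * ((N : ℝ) ^ ε * ((N : ℝ) ^ (k + 1) * E))) := by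
        gcongr
    _ = _ := by ring

/-! ### Kernels, their transforms and exponential means -/

/-- The exponential sum `∑_{m = 1}^{t} e(α P(m))`. -/
noncomputable def expSum (P : ℤ[X]) (t : ℕ) (α : ℝ) : ℂ :=
  ∑ m ∈ Finset.range t, e (α * ((P.eval ((m : ℤ) + 1) : ℤ) : ℝ))

/-- The average `(1 / t) ∑_{m = 1}^{t} e(α P(m))`. -/
noncomputable def expMean (P : ℤ[X]) (t : ℕ) (α : ℝ) : ℂ := expSum P t α / t

lemma fourierZ_sub (f g : ℤ →₀ ℂ) (α : ℝ) :
    fourierZ (f - g) α = fourierZ f α - fourierZ g α :=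
  Finsupp.sum_sub_index fun _ _ _ => sub_mul _ _ _

lemma fourierZ_add (f g : ℤ →₀ ℂ) (α : ℝ) :
    fourierZ (f + g) α = fourierZ f α + fourierZ g α :=
  Finsupp.sum_add_index' (fun _ => zero_mul _) fun _ _ _ => add_mul _ _ _

lemma fourierZ_smul (c : ℂ) (f : ℤ →₀ ℂ) (α : ℝ) : fourierZ (c • f) α = c * fourierZ f α := by
  unfold fourierZ
  rw [Finsupp.sum_smul_index (fun _ => zero_mul _), Finsupp.mul_sum]
  simp only [mul_assoc]

lemma fourierZ_single (x : ℤ) (α : ℝ) :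
    fourierZ (Finsupp.single x 1) α = (starRingEnd ℂ) (e (α * x)) := by
  unfold fourierZ
  rw [Finsupp.sum_single_index (zero_mul _), one_mul, ← e_neg]
  unfold e
  congr 1; push_cast; ring

lemma fourierZ_kernelK (P : ℤ[X]) (t : ℕ) (α : ℝ) :
    fourierZ (kernelK P t) α = (starRingEnd ℂ) (expMean P t α) := by
  have h : ∀ s : Finset ℕ,
      fourierZ (∑ m ∈ s, Finsupp.single (P.eval (m : ℤ)) (1 : ℂ)) α =
        ∑ m ∈ s, (starRingEnd ℂ) (e (α * ((P.eval (m : ℤ) : ℤ) : ℝ))) := by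
    intro s
    induction s using Finset.induction_on with
    | empty => simp [fourierZ]
    | insert a s ha ih => rw [Finset.sum_insert ha, Finset.sum_insert ha, fourierZ_add, ih,
        fourierZ_single]
  unfold kernelK expMean expSum
  have h2 : ∑ m ∈ Finset.Icc 1 t, (starRingEnd ℂ) (e (α * ((P.eval (m : ℤ) : ℤ) : ℝ))) =
      ∑ m ∈ Finset.range t, (starRingEnd ℂ) (e (α * ((P.eval ((m : ℤ) + 1) : ℤ) : ℝ))) := by
    rw [Finset.range_eq_Ico, show Finset.Icc 1 t = Finset.Ico (0 + 1) (t + 1) from rfl,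
      ← Finset.sum_Ico_add']
    simp
  rw [fourierZ_smul, h, h2, map_div₀, map_sum, map_natCast]
  ring

lemma norm_fourierZ_kernelC (P : ℤ[X]) (n t : ℕ) (α : ℝ) :
    ‖fourierZ (kernelC P n t) α‖ = ‖expMean P t α - expMean P (2 ^ n) α‖ := by
  rw [kernelC, fourierZ_sub, fourierZ_kernelK, fourierZ_kernelK, ← map_sub, Complex.norm_conj]

lemma norm_expSum_le (P : ℤ[X]) (t : ℕ) (α : ℝ) : ‖expSum P t α‖ ≤ t := norm_sum_e_le t _

lemma norm_expMean_le_one (P : ℤ[X]) (t : ℕ) (α : ℝ) : ‖expMean P t α‖ ≤ 1 := by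
  rw [expMean, norm_div, Complex.norm_natCast]
  exact div_le_one_of_le₀ (norm_expSum_le P t α) (by positivity)

/-- The difference of consecutive means is (old mean - new term)/(t + 1). -/
lemma norm_expMean_sub_succ_le (P : ℤ[X]) {t : ℕ} (ht : 1 ≤ t) (α : ℝ) :
    ‖expMean P t α - expMean P (t + 1) α‖ ≤ 2 / t := by
  have ht' : (0 : ℝ) < t := by exact_mod_cast ht
  have htc : (t : ℂ) ≠ 0 := by exact_mod_cast ht'.ne'
  have htc' : (t : ℂ) + 1 ≠ 0 := by exact_mod_cast (Nat.succ_ne_zero t)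
  set z := e (α * ((P.eval ((t : ℤ) + 1) : ℤ) : ℝ)) with hz
  have h : expSum P (t + 1) α = expSum P t α + z := Finset.sum_range_succ _ _
  have h2 : expMean P t α - expMean P (t + 1) α = (expMean P t α - z) / ((t + 1 : ℕ) : ℂ) := by
    unfold expMean; rw [h]; push_cast; field_simp; ring
  rw [h2, norm_div, Complex.norm_natCast]
  have h3 : ‖expMean P t α - z‖ ≤ 2 := by
    refine (norm_sub_le _ _).trans ?_
    have := norm_expMean_le_one P t α
    rw [hz, norm_e]; linarith
  gcongr
  omega

/-- The sums start at m = 1, so P is shifted by 1. A Taylor shift preserves the top coefficient,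
hence Weyl's inequality sees b_d α. -/
lemma exists_real_poly (P : ℤ[X]) (α : ℝ) :
    ∃ f : ℝ[X], f.natDegree ≤ P.natDegree ∧ f.coeff P.natDegree = P.leadingCoeff * α ∧
      ∀ m : ℕ, f.eval (m : ℝ) = α * ((P.eval ((m : ℤ) + 1) : ℤ) : ℝ) := by
  have hd : (P.map (Int.castRingHom ℝ)).natDegree = P.natDegree :=
    natDegree_map_eq_of_injective Int.cast_injective P
  refine ⟨C α * taylor 1 (P.map (Int.castRingHom ℝ)), ?_, ?_, fun m => ?_⟩
  · refine (natDegree_C_mul_le _ _).trans ?_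
    rw [natDegree_taylor, hd]
  · rw [coeff_C_mul]
    conv_lhs => rw [← hd, coeff_taylor_natDegree, leadingCoeff, hd, coeff_map]
    rw [mul_comm]; rfl
  · rw [eval_mul, eval_C, taylor_eval]
    congr 1
    have := eval_intCast_map (Int.castRingHom ℝ) P ((m : ℤ) + 1)
    push_cast at this
    exact this

/-- Weyl's inequality for the averages. -/
lemma norm_expMean_pow_le (P : ℤ[X]) (hd : 1 ≤ P.natDegree) {ε : ℝ} (hε : 0 < ε) :
    ∃ C : ℝ, 1 ≤ C ∧ ∀ (α : ℝ) (a : ℤ) (q N : ℕ), 1 ≤ q → IsCoprime a (q : ℤ) →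
      |P.leadingCoeff * α - a / q| ≤ 1 / (q : ℝ) ^ 2 → 1 ≤ N →
      (q : ℝ) ≤ (N : ℝ) ^ P.natDegree →
      ‖expMean P N α‖ ^ (2 ^ (P.natDegree - 1)) ≤
        C * ((N : ℝ) ^ ε * (1 / q + 1 / N + q / (N : ℝ) ^ P.natDegree)) := by
  obtain ⟨k, hk⟩ : ∃ k, P.natDegree = k + 1 := ⟨P.natDegree - 1, by omega⟩
  obtain ⟨C, hC, h⟩ := weyl_inequality k hε
  refine ⟨max C 1, le_max_right _ _, fun α a q N hq hc hα hN hqN => ?_⟩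
  obtain ⟨f, hf1, hf2, hf3⟩ := exists_real_poly P α
  rw [hk] at hf1 hf2 hqN ⊢
  have h1 := h f a q N hf1 hq hc (by rw [hf2]; exact hα) hN hqN
  simp only [hf3] at h1
  have hN' : (0 : ℝ) < N := by exact_mod_cast hN
  rw [expMean, norm_div, Complex.norm_natCast, div_pow, Nat.add_sub_cancel,
    div_le_iff₀ (by positivity)]
  refine h1.trans ?_
  rw [mul_right_comm]
  gcongr
  exact le_max_left _ _

/-- Takes K-th roots in Weyl's inequality; C ≤ C^K allows the same constant to be kept. -/
lemma le_mul_of_pow_le {x B C : ℝ} {K : ℕ} (hB : 0 ≤ B) (hC : 1 ≤ C) (hK : K ≠ 0)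
    (h : x ^ K ≤ C * B ^ K) : x ≤ C * B := by
  refine le_of_pow_le_pow_left₀ hK (by positivity) (h.trans ?_)
  rw [mul_pow]
  gcongr
  exact le_self_pow₀ hC hK

/-! ### Minor arcs -/

lemma arcDist_eq (P : ℤ[X]) {a q : ℕ} (haq : a < q) (α : ℝ) :
    ∃ z : ℤ, arcDist P a q α = |P.leadingCoeff * α - z - a / q| := by
  unfold arcDist
  split_ifs with h
  · obtain rfl : a = 0 := by omega
    exact ⟨round (P.leadingCoeff * α : ℝ), by simp⟩
  · exact ⟨⌊(P.leadingCoeff * α : ℝ)⌋, by rw [Int.fract]⟩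

/-- Dirichlet's theorem at height 2^(n(d-δ)) approximates the fractional part of b_d α. The error is
below the major arc radius, so being off the major arcs excludes every shell with s ≤ nδ and forces
the denominator up. -/
lemma exists_approx_of_mem_minorArcs {P : ℤ[X]} (hd : 1 ≤ P.natDegree) {δ : ℝ} (hδ : 0 < δ)
    (hδ1 : δ < 1) {n : ℕ} {α : ℝ} (hα : α ∈ minorArcs P δ n) :
    ∃ (a : ℤ) (q : ℕ), 1 ≤ q ∧ IsCoprime a (q : ℤ) ∧
      |P.leadingCoeff * α - a / q| ≤ 1 / (q : ℝ) ^ 2 ∧ (2 : ℝ) ^ (n * δ) ≤ q ∧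
      (q : ℝ) ≤ (2 : ℝ) ^ (n * (P.natDegree - δ)) := by
  have hd' : (1 : ℝ) ≤ P.natDegree := by exact_mod_cast hd
  set Y : ℝ := (2 : ℝ) ^ (n * (P.natDegree - δ)) with hY
  have hY1 : 1 ≤ Y := Real.one_le_rpow (by norm_num) (mul_nonneg (by positivity) (by linarith))
  set M := ⌊Y⌋₊ with hM
  have hM1 : 0 < M := Nat.floor_pos.2 hY1
  have hMY : (M : ℝ) ≤ Y := Nat.floor_le (by linarith)
  have hYM : Y < M + 1 := Nat.lt_floor_add_one Y
  set b : ℝ := P.leadingCoeff * α with hb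
  set x := Int.fract b with hx
  have hx0 : 0 ≤ x := Int.fract_nonneg b
  have hx1 : x < 1 := Int.fract_lt_one b
  obtain ⟨r, hr, hrM⟩ := Real.exists_rat_abs_sub_le_and_den_le x hM1
  set q := r.den with hq
  have hq1 : 1 ≤ q := r.den_pos
  have hq0 : (0 : ℝ) < q := by exact_mod_cast hq1
  have hqM : (q : ℝ) ≤ M := by exact_mod_cast hrM
  have hrr : (r : ℝ) = (r.num : ℝ) / q := by rw [hq]; exact Rat.cast_def r
  -- Dirichlet's bound has M + 1 > Y in the denominator, which gives the strict inequality in the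
  -- definition of a major arc.
  have hlt : |x - r| < 1 / Y / q := by
    refine hr.trans_lt ?_
    rw [div_div]
    apply one_div_lt_one_div_of_lt (by positivity)
    gcongr
  have hltq : |x - r| < 1 / q := by
    refine hlt.trans_le ?_
    gcongr
    rw [div_le_one (by linarith)]; exact hY1
  have hltY : |x - r| < (2 : ℝ) ^ (-((n : ℝ) * ((P.natDegree : ℝ) - δ))) := by
    rw [Real.rpow_neg (by norm_num), ← hY, ← one_div]
    refine hlt.trans_le (div_le_self (by positivity) (by exact_mod_cast hq1))
  have hsq : |x - r| ≤ 1 / (q : ℝ) ^ 2 := by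
    refine hlt.le.trans ?_
    rw [div_div, sq]
    apply one_div_le_one_div_of_le (by positivity)
    gcongr
    linarith
  have hnum0 : 0 ≤ r.num := by
    by_contra h
    have h1 : (r.num : ℝ) ≤ -1 := by exact_mod_cast (by omega : r.num ≤ -1)
    have h2 : (r : ℝ) ≤ -1 / q := by rw [hrr]; gcongr
    have h3 := le_abs_self (x - r)
    have h4 : -1 / (q : ℝ) = -(1 / q) := by ring
    linarith
  have hnumq : r.num ≤ q := by
    by_contra h
    have h1 : (q : ℝ) + 1 ≤ (r.num : ℝ) := by exact_mod_cast (by omega : (q : ℤ) + 1 ≤ r.num)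
    have h2 : ((q : ℝ) + 1) / q ≤ r := by rw [hrr]; gcongr
    have h3 := neg_abs_le (x - r)
    have h4 : ((q : ℝ) + 1) / q = 1 + 1 / q := by field_simp
    linarith
  have hcop : IsCoprime r.num (q : ℤ) := Rat.isCoprime_num_den r
  have hfl : b = x + ⌊b⌋ := (Int.fract_add_floor b).symm
  obtain ⟨p, hp⟩ := Int.eq_ofNat_of_zero_le hnum0
  have hn0 : 0 ≤ (n : ℝ) * δ := by positivity
  have hnot : ∀ s : ℕ, (s : ℝ) ≤ n * δ → ∀ a' q' : ℕ, (a', q') ∈ ratShell s →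
      ¬ arcDist P a' q' α < (2 : ℝ) ^ (-((n : ℝ) * ((P.natDegree : ℝ) - δ))) :=
    fun s hs a' q' hr' h => hα ⟨s, hs, a', q', hr', h⟩
  -- Denominator 1 allows both 0/1 and 1/1; the distance to the nearest integer at 0/1 covers both.
  have hq2 : q ≠ 1 := by
    intro h1
    refine hnot 0 (by simpa using hn0) 0 1 (by simp [ratShell]) ?_
    unfold arcDist
    rw [if_pos rfl]
    refine lt_of_le_of_lt ?_ hltY
    refine (round_le _ (⌊b⌋ + r.num)).trans (le_of_eq ?_)
    rw [← hb, hrr, h1]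
    congr 1
    push_cast
    linarith
  have hpq : p < q := by
    have h1 : p ≤ q := by exact_mod_cast hp ▸ hnumq
    refine lt_of_le_of_ne h1 fun h2 => hq2 ?_
    have h3 : r.num = q := by rw [hp, h2]
    rw [h3] at hcop
    have := isCoprime_self.1 hcop
    rw [Int.isUnit_iff] at this
    omega
  -- The integer part of b_d α returns to the numerator, which does not affect coprimality with q.
  refine ⟨r.num + ⌊b⌋ * q, q, hq1, ?_, ?_, ?_, hqM.trans hMY⟩
  · exact IsCoprime.add_mul_right_left_iff.2 hcop
  · refine le_trans (le_of_eq ?_) hsq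
    rw [hrr]
    congr 1
    push_cast
    rw [add_div, mul_div_cancel_right₀ _ hq0.ne']
    linarith
  · have hs1 : 2 ^ Nat.log 2 q ≤ q := Nat.pow_log_le_self 2 (by omega)
    have hs2 : q < 2 ^ (Nat.log 2 q + 1) := Nat.lt_pow_succ_log_self (by norm_num) q
    have h1 : (n : ℝ) * δ < (Nat.log 2 q : ℕ) := by
      by_contra h
      refine hnot _ (not_lt.1 h) p q ⟨hpq, ?_, hs1, hs2⟩ ?_
      · rw [hp] at hcop
        exact Nat.isCoprime_iff_coprime.1 hcop
      · unfold arcDist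
        rw [if_neg hq2, ← hb, ← hx]
        rw [hrr, hp, Int.cast_natCast] at hltY
        exact hltY
    calc (2 : ℝ) ^ (n * δ) ≤ (2 : ℝ) ^ ((Nat.log 2 q : ℕ) : ℝ) := by
          apply Real.rpow_le_rpow_of_exponent_le (by norm_num) h1.le
      _ = ((2 ^ Nat.log 2 q : ℕ) : ℝ) := by rw [Real.rpow_natCast]; push_cast; rfl
      _ ≤ q := by exact_mod_cast hs1

/-- The minor arc estimate. -/
lemma exists_minor_bound {P : ℤ[X]} (hd : 1 ≤ P.natDegree) {δ : ℝ} (hδ : 0 < δ) (hδ1 : δ < 1) :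
    ∃ ν : ℝ, 0 < ν ∧ ∃ C : ℝ, 0 < C ∧ ∀ n t : ℕ, 2 ^ n ≤ t → t ≤ 2 ^ (n + 1) →
      ∀ α ∈ minorArcs P δ n, ‖expMean P t α‖ ≤ C * (2 : ℝ) ^ (-((n : ℝ) * ν)) := by
  obtain ⟨C, hC, h⟩ := norm_expMean_pow_le P hd (ε := δ / 2) (by positivity)
  set K := 2 ^ (P.natDegree - 1) with hK
  have hK0 : K ≠ 0 := by positivity
  have hK' : (0 : ℝ) < K := by exact_mod_cast Nat.pos_of_ne_zero hK0
  -- Each of the three terms in Weyl's inequality is at most 2^(-nδ), while t^(δ/2) ≤ 2 · 2^(nδ/2).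
  -- The product is at most 6 · 2^(-nδ/2), and a K-th root remains to be taken.
  refine ⟨δ / 2 / K, by positivity, 6 * C, by positivity, fun n t ht1 ht2 α hα => ?_⟩
  obtain ⟨a, q, hq, hc, haq, hq1, hq2⟩ := exists_approx_of_mem_minorArcs hd hδ hδ1 hα
  have ht : 1 ≤ t := le_trans Nat.one_le_two_pow ht1
  have ht1' : (2 : ℝ) ^ (n : ℝ) ≤ t := by rw [Real.rpow_natCast]; exact_mod_cast ht1
  have ht2' : (t : ℝ) ≤ 2 * 2 ^ (n : ℝ) := by
    rw [Real.rpow_natCast, ← pow_succ']; exact_mod_cast ht2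
  have ht0 : (0 : ℝ) < t := by exact_mod_cast ht
  have h2n : (0 : ℝ) < 2 ^ (n : ℝ) := by positivity
  have htd : (2 : ℝ) ^ (n * (P.natDegree : ℝ)) ≤ (t : ℝ) ^ P.natDegree := by
    rw [Real.rpow_mul (by norm_num), Real.rpow_natCast ((2 : ℝ) ^ (n : ℝ))]
    gcongr
  have hq0 : (0 : ℝ) < q := by exact_mod_cast hq
  have hmono : ∀ {x y : ℝ}, x ≤ y → (2 : ℝ) ^ x ≤ 2 ^ y := fun h =>
    Real.rpow_le_rpow_of_exponent_le (by norm_num) h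
  have hn : (0 : ℝ) ≤ n := by positivity
  have hqt : (q : ℝ) ≤ (t : ℝ) ^ P.natDegree :=
    hq2.trans ((hmono (by nlinarith)).trans htd)
  have h1 := h α a q t hq hc haq ht hqt
  · refine le_mul_of_pow_le (K := K) (by positivity) (by linarith) hK0 (h1.trans ?_)
    have hB : ((2 : ℝ) ^ (-((n : ℝ) * (δ / 2 / K)))) ^ K = 2 ^ (-(n * δ)) * 2 ^ (n * (δ / 2)) := by
      rw [← Real.rpow_natCast, ← Real.rpow_mul (by norm_num), ← Real.rpow_add (by norm_num)]
      congr 1; field_simp; ring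
    have e1 : 1 / (q : ℝ) ≤ 2 ^ (-(n * δ)) := by
      rw [Real.rpow_neg (by norm_num), ← one_div]
      exact one_div_le_one_div_of_le (by positivity) hq1
    have e2 : 1 / (t : ℝ) ≤ 2 ^ (-(n * δ)) := by
      rw [Real.rpow_neg (by norm_num), ← one_div]
      exact one_div_le_one_div_of_le (by positivity) ((hmono (by nlinarith)).trans ht1')
    have e3 : (q : ℝ) / (t : ℝ) ^ P.natDegree ≤ 2 ^ (-(n * δ)) := by
      rw [div_le_iff₀ (by positivity)]
      refine hq2.trans (le_trans (le_of_eq ?_) (mul_le_mul_of_nonneg_left htd (by positivity)))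
      rw [← Real.rpow_add (by norm_num)]; congr 1; ring
    have e4 : (t : ℝ) ^ (δ / 2) ≤ 2 * 2 ^ (n * (δ / 2)) := by
      calc (t : ℝ) ^ (δ / 2) ≤ (2 * 2 ^ (n : ℝ)) ^ (δ / 2) := by gcongr
        _ = 2 ^ (δ / 2) * 2 ^ (n * (δ / 2)) := by
            rw [Real.mul_rpow (by norm_num) (by positivity), ← Real.rpow_mul (by norm_num)]
        _ ≤ _ := by
            gcongr
            calc (2 : ℝ) ^ (δ / 2) ≤ 2 ^ (1 : ℝ) := hmono (by linarith)
              _ = 2 := Real.rpow_one 2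
    rw [hB]
    calc C * ((t : ℝ) ^ (δ / 2) * (1 / q + 1 / t + q / (t : ℝ) ^ P.natDegree))
        ≤ C * (2 * 2 ^ (n * (δ / 2)) * (2 ^ (-(n * δ)) + 2 ^ (-(n * δ)) + 2 ^ (-(n * δ)))) := by
          gcongr
      _ = _ := by ring

/-! ### Summation by parts and periodic phases -/

/-- Summation by parts, as an inequality. -/
lemma norm_sum_mul_le {v u : ℕ → ℂ} {B : ℝ}
    (hv : ∀ n, ‖∑ m ∈ Finset.range n, v m‖ ≤ B) (hu : ∀ n, ‖u n‖ ≤ 1) (t : ℕ) :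
    ‖∑ m ∈ Finset.range t, v m * u m‖ ≤
      B * (1 + ∑ m ∈ Finset.range t, ‖u (m + 1) - u m‖) := by
  have hB : 0 ≤ B := (norm_nonneg _).trans (hv 0)
  have key : ∑ m ∈ Finset.range t, v m * u m = (∑ m ∈ Finset.range t, v m) * u t -
      ∑ m ∈ Finset.range t, (∑ j ∈ Finset.range (m + 1), v j) * (u (m + 1) - u m) := by
    induction t with
    | zero => simp
    | succ t ih =>
      rw [Finset.sum_range_succ, ih, Finset.sum_range_succ _ t,
        Finset.sum_range_succ (fun m => (∑ j ∈ Finset.range (m + 1), v j) * (u (m + 1) - u m)),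
        Finset.sum_range_succ v t]
      ring
  rw [key]
  refine (norm_sub_le _ _).trans ?_
  rw [mul_add, mul_one, Finset.mul_sum]
  refine add_le_add ?_ ((norm_sum_le _ _).trans (Finset.sum_le_sum fun m _ => ?_))
  · rw [norm_mul]
    exact (mul_le_mul (hv t) (hu t) (norm_nonneg _) hB).trans (mul_one B).le
  · rw [norm_mul]
    exact mul_le_mul_of_nonneg_right (hv _) (norm_nonneg _)

/-- Full periods of w minus its mean cancel; fewer than Q terms of size at most 2 remain. -/
lemma norm_sum_periodic_sub_mean_le {w : ℕ → ℂ} {Q : ℕ} (hQ : 1 ≤ Q) (hw : ∀ n, ‖w n‖ ≤ 1)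
    (hper : ∀ n, w (Q + n) = w n) (n : ℕ) :
    ‖∑ m ∈ Finset.range n, (w m - (∑ j ∈ Finset.range Q, w j) / Q)‖ ≤ 2 * Q := by
  set G := (∑ j ∈ Finset.range Q, w j) / Q with hG
  have hQ' : (0 : ℝ) < Q := by exact_mod_cast hQ
  have hQc : (Q : ℂ) ≠ 0 := by exact_mod_cast hQ'.ne'
  have hG1 : ‖G‖ ≤ 1 := by
    rw [hG, norm_div, Complex.norm_natCast]
    refine div_le_one_of_le₀ ((norm_sum_le _ _).trans ?_) hQ'.le
    exact (Finset.sum_le_sum fun m _ => hw m).trans (by simp)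
  have h0 : ∑ m ∈ Finset.range Q, (w m - G) = 0 := by
    rw [Finset.sum_sub_distrib, Finset.sum_const, Finset.card_range, nsmul_eq_mul, hG]
    field_simp; ring
  induction n using Nat.strong_induction_on with
  | _ n ih =>
    rcases Nat.lt_or_ge n Q with h | h
    · refine (norm_sum_le _ _).trans ?_
      calc ∑ m ∈ Finset.range n, ‖w m - G‖ ≤ ∑ m ∈ Finset.range n, (2 : ℝ) :=
            Finset.sum_le_sum fun m _ => (norm_sub_le _ _).trans (by linarith [hw m])
        _ = n * 2 := by simp
        _ ≤ 2 * Q := by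
            have : (n : ℝ) ≤ Q := by exact_mod_cast h.le
            linarith
    · obtain ⟨j, rfl⟩ := Nat.exists_eq_add_of_le h
      rw [Finset.sum_range_add, h0, zero_add]
      simp only [hper]
      exact ih j (by omega)

lemma e_rational_periodic (P : ℤ[X]) (A : ℤ) {Q : ℕ} (hQ : 1 ≤ Q) (x : ℤ) :
    e ((A / Q : ℝ) * ((P.eval (Q + x) : ℤ) : ℝ)) = e ((A / Q : ℝ) * ((P.eval x : ℤ) : ℝ)) := by
  have hQ' : (Q : ℝ) ≠ 0 := by exact_mod_cast (by omega : Q ≠ 0)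
  obtain ⟨z, hz⟩ := sub_dvd_eval_sub (Q + x) x P
  rw [add_sub_cancel_right] at hz
  have h : (A / Q : ℝ) * ((P.eval (Q + x) : ℤ) : ℝ) =
      (A / Q : ℝ) * ((P.eval x : ℤ) : ℝ) + ((A * z : ℤ) : ℝ) := by
    rw [eq_add_of_sub_eq hz]; push_cast; field_simp; ring
  rw [h, e_add_int]

lemma expMean_rational_mul (P : ℤ[X]) (A : ℤ) {Q : ℕ} (hQ : 1 ≤ Q) {j : ℕ} (hj : 1 ≤ j) :
    expMean P (j * Q) (A / Q) = expMean P Q (A / Q) := by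
  have hQc : (Q : ℂ) ≠ 0 := by exact_mod_cast (by omega : Q ≠ 0)
  have hjc : (j : ℂ) ≠ 0 := by exact_mod_cast (by omega : j ≠ 0)
  have h : ∀ j : ℕ, expSum P (j * Q) (A / Q) = j * expSum P Q (A / Q) := by
    intro j
    induction j with
    | zero => simp [expSum]
    | succ j ih =>
      have h1 : expSum P (Q + j * Q) (A / Q) =
          expSum P Q (A / Q) + expSum P (j * Q) (A / Q) := by
        unfold expSum
        rw [Finset.sum_range_add]
        congr 1
        refine Finset.sum_congr rfl fun m _ => ?_
        have := e_rational_periodic P A hQ (m + 1)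
        rw [← this]; push_cast; rw [add_assoc]
      rw [Nat.succ_mul, add_comm (j * Q), h1, ih]
      push_cast; ring
  unfold expMean
  rw [h]; push_cast; field_simp

/-! ### Growth of P, Kusmin–Landau and decay at small frequencies -/

lemma abs_eval_le {p : ℝ[X]} {k : ℕ} (hp : p.natDegree ≤ k) :
    ∃ B : ℝ, 0 < B ∧ ∀ x : ℝ, 1 ≤ x → |p.eval x| ≤ B * x ^ k := by
  refine ⟨∑ i ∈ Finset.range (k + 1), |p.coeff i| + 1, by positivity, fun x hx => ?_⟩
  rw [eval_eq_sum_range' (Nat.lt_succ_of_le hp)]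
  have h1 : ∑ i ∈ Finset.range (k + 1), |p.coeff i * x ^ i| ≤
      ∑ i ∈ Finset.range (k + 1), |p.coeff i| * x ^ k := by
    refine Finset.sum_le_sum fun i hi => ?_
    rw [abs_mul, abs_of_nonneg (by positivity : 0 ≤ x ^ i)]
    gcongr
    exact Nat.lt_succ_iff.1 (Finset.mem_range.1 hi)
  refine (Finset.abs_sum_le_sum_abs _ _).trans (h1.trans ?_)
  rw [← Finset.sum_mul, add_mul]
  have : 0 ≤ 1 * x ^ k := by positivity
  linarith

lemma eventually_eval_nonneg {p : ℝ[X]} {k : ℕ} (hp : p.natDegree ≤ k) (h : 0 < p.coeff k) :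
    ∀ᶠ x : ℝ in Filter.atTop, 0 ≤ p.eval x := by
  have hk : p.natDegree = k := le_antisymm hp (le_natDegree_of_ne_zero h.ne')
  have hl : 0 < p.leadingCoeff := by rw [leadingCoeff, hk]; exact h
  rcases Nat.eq_zero_or_pos k with rfl | hk0
  · refine Filter.Eventually.of_forall fun x => ?_
    rw [eq_C_of_natDegree_eq_zero hk, eval_C]; exact h.le
  · exact (tendsto_atTop_of_leadingCoeff_nonneg p
      (natDegree_pos_iff_degree_pos.1 (hk ▸ hk0)) hl.le).eventually_ge_atTop 0

lemma eventually_mul_pow_le_eval {p : ℝ[X]} {k : ℕ} (hp : p.natDegree ≤ k)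
    (h : 0 < p.coeff k) :
    ∀ᶠ x : ℝ in Filter.atTop, p.coeff k / 2 * x ^ k ≤ p.eval x := by
  have h1 : (p - C (p.coeff k / 2) * X ^ k).natDegree ≤ k :=
    (natDegree_sub_le _ _).trans (max_le hp (natDegree_C_mul_X_pow_le _ _))
  have h2 : 0 < (p - C (p.coeff k / 2) * X ^ k).coeff k := by
    rw [coeff_sub, coeff_C_mul_X_pow, if_pos rfl]; linarith
  filter_upwards [eventually_eval_nonneg h1 h2] with x hx
  simpa using hx

/-- The Kusmin–Landau inequality for a phase with increasing differences. -/
lemma norm_sum_e_le_of_monotone {φ : ℕ → ℝ} {L : ℕ} {l : ℝ} (hl : 0 < l)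
    (hlow : ∀ m ≤ L, l ≤ φ (m + 1) - φ m) (hup : ∀ m ≤ L, φ (m + 1) - φ m ≤ 1 / 2)
    (hmono : ∀ m < L, φ (m + 1) - φ m ≤ φ (m + 1 + 1) - φ (m + 1)) :
    ‖∑ m ∈ Finset.range L, e (φ m)‖ ≤ 1 / l := by
  set Δ : ℕ → ℝ := fun m => φ (m + 1) - φ m with hΔ
  -- Each term is c_m times a difference of consecutive exponentials, so Abel summation moves the
  -- differences to c. Monotone Δ makes the variation of c telescope to at most 1/(2l), and the two
  -- boundary terms add 1/(4l) each.
  set c : ℕ → ℂ := fun m => (e (Δ m) - 1)⁻¹ with hc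
  have hpos : ∀ m ≤ L, 0 < Δ m := fun m hm => hl.trans_le (hlow m hm)
  have hnorm : ∀ m ≤ L, 4 * Δ m ≤ ‖e (Δ m) - 1‖ := fun m hm => by
    have h := four_mul_abs_le_norm_e_sub_one (x := Δ m)
      (by rw [abs_of_pos (hpos m hm)]; exact hup m hm)
    rwa [abs_of_pos (hpos m hm)] at h
  have hne : ∀ m ≤ L, e (Δ m) - 1 ≠ 0 := fun m hm => by
    rw [← norm_pos_iff]; linarith [hnorm m hm, hpos m hm]
  have hcb : ∀ m ≤ L, ‖c m‖ ≤ 1 / (4 * l) := fun m hm => by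
    rw [hc, norm_inv, ← one_div]
    exact one_div_le_one_div_of_le (by positivity) (by linarith [hnorm m hm, hlow m hm])
  have hz : ∀ m ≤ L, e (φ m) = c m * (e (φ (m + 1)) - e (φ m)) := fun m hm => by
    have h1 : e (φ (m + 1)) = e (φ m) * e (Δ m) := by
      rw [← e_add]; congr 1; simp only [hΔ]; ring
    rw [h1, hc]
    field_simp [hne m hm]
  have hcd : ∀ m < L, ‖c m - c (m + 1)‖ ≤ 1 / 2 * (1 / Δ m - 1 / Δ (m + 1)) := by
    intro m hm
    have p1 := hpos m hm.le
    have p2 := hpos (m + 1) hm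
    have hd : 0 ≤ Δ (m + 1) - Δ m := sub_nonneg.2 (hmono m hm)
    have h1 : c m - c (m + 1) =
        (e (Δ (m + 1)) - e (Δ m)) / ((e (Δ m) - 1) * (e (Δ (m + 1)) - 1)) := by
      have := hne m hm.le
      have := hne (m + 1) hm
      simp only [hc]; field_simp; ring
    rw [h1, norm_div, norm_mul]
    have h2 := norm_e_sub_e_le (Δ (m + 1)) (Δ m)
    rw [abs_of_nonneg hd] at h2
    calc ‖e (Δ (m + 1)) - e (Δ m)‖ / (‖e (Δ m) - 1‖ * ‖e (Δ (m + 1)) - 1‖)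
        ≤ 2 * Real.pi * (Δ (m + 1) - Δ m) / (4 * Δ m * (4 * Δ (m + 1))) := by
          gcongr
          · exact hnorm m hm.le
          · exact hnorm (m + 1) hm
      _ ≤ 8 * (Δ (m + 1) - Δ m) / (4 * Δ m * (4 * Δ (m + 1))) := by
          gcongr
          linarith [Real.pi_le_four]
      _ = _ := by field_simp; ring
  have key : ∀ j ≤ L, ‖∑ m ∈ Finset.range j, e (φ m) - c j * e (φ j) + c 0 * e (φ 0)‖ ≤
      1 / 2 * (1 / Δ 0 - 1 / Δ j) := by
    intro j
    induction j with
    | zero => intro _; simp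
    | succ j ih =>
      intro hj
      have h1 : ∑ m ∈ Finset.range (j + 1), e (φ m) - c (j + 1) * e (φ (j + 1)) +
          c 0 * e (φ 0) = (∑ m ∈ Finset.range j, e (φ m) - c j * e (φ j) + c 0 * e (φ 0)) +
          (c j - c (j + 1)) * e (φ (j + 1)) := by
        rw [Finset.sum_range_succ]
        linear_combination hz j (by omega)
      rw [h1]
      refine (norm_add_le _ _).trans ?_
      rw [norm_mul, norm_e, mul_one]
      have := ih (by omega)
      have := hcd j (by omega)
      linarith
  have h1 := key L le_rfl
  have h2 : 1 / Δ 0 ≤ 1 / l := one_div_le_one_div_of_le hl (hlow 0 (Nat.zero_le _))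
  have h3 : 0 < 1 / Δ L := one_div_pos.2 (hpos L le_rfl)
  have h4 : ∑ m ∈ Finset.range L, e (φ m) =
      (∑ m ∈ Finset.range L, e (φ m) - c L * e (φ L) + c 0 * e (φ 0)) +
        c L * e (φ L) - c 0 * e (φ 0) := by ring
  rw [h4]
  refine (norm_sub_le _ _).trans ?_
  have h5 := norm_add_le
    (∑ m ∈ Finset.range L, e (φ m) - c L * e (φ L) + c 0 * e (φ 0)) (c L * e (φ L))
  rw [norm_mul, norm_e, mul_one] at h5
  rw [norm_mul, norm_e, mul_one]
  have h6 := hcb L le_rfl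
  have h7 := hcb 0 (Nat.zero_le _)
  have h8 : 1 / (4 * l) = 1 / l / 4 := by field_simp
  linarith

lemma norm_expSum_neg (P : ℤ[X]) (t : ℕ) (α : ℝ) : ‖expSum P t (-α)‖ = ‖expSum P t α‖ := by
  rw [← Complex.norm_conj]
  congr 1
  unfold expSum
  rw [map_sum]
  refine Finset.sum_congr rfl fun m _ => ?_
  rw [neg_mul, e_neg, Complex.conj_conj]

/-- The value `P(m)` as a real number. -/
noncomputable def polyVal (P : ℤ[X]) (m : ℕ) : ℝ := ((P.eval (m : ℤ) : ℤ) : ℝ)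

lemma expSum_eq (P : ℤ[X]) (t : ℕ) (α : ℝ) :
    expSum P t α = ∑ m ∈ Finset.range t, e (α * polyVal P (m + 1)) := by
  unfold expSum polyVal; push_cast; rfl

lemma polyVal_eq (P : ℤ[X]) (m : ℕ) :
    polyVal P m = (P.map (Int.castRingHom ℝ)).eval (m : ℝ) := by
  have := eval_intCast_map (Int.castRingHom ℝ) P (m : ℤ)
  push_cast at this
  exact this.symm

/-- The first difference of P has degree d - 1 and positive top coefficient. It is thus eventually
of order m^(d-1), and its own difference is eventually nonnegative, as Kusmin–Landau requires. -/
lemma exists_growth_bounds {P : ℤ[X]} (hd : 1 ≤ P.natDegree) (hP : 0 < P.leadingCoeff) :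
    ∃ (B c : ℝ) (x₀ : ℕ), 0 < B ∧ 0 < c ∧
      (∀ m : ℕ, 1 ≤ m → |polyVal P m| ≤ B * (m : ℝ) ^ P.natDegree) ∧
      (∀ m : ℕ, 1 ≤ m →
        |polyVal P (m + 1) - polyVal P m| ≤ B * (m : ℝ) ^ (P.natDegree - 1)) ∧
      (∀ m : ℕ, x₀ ≤ m →
        c * (m : ℝ) ^ (P.natDegree - 1) ≤ polyVal P (m + 1) - polyVal P m) ∧
      (∀ m : ℕ, x₀ ≤ m →
        polyVal P (m + 1) - polyVal P m ≤ polyVal P (m + 1 + 1) - polyVal P (m + 1)) := by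
  obtain ⟨k, hk⟩ : ∃ k, P.natDegree = k + 1 := ⟨P.natDegree - 1, by omega⟩
  set p := P.map (Int.castRingHom ℝ) with hp
  have hpd : p.natDegree = k + 1 := by
    rw [← hk]; exact natDegree_map_eq_of_injective Int.cast_injective P
  have hlc : 0 < p.coeff (k + 1) := by
    rw [hp, coeff_map, ← hk]
    have : (0 : ℝ) < (P.leadingCoeff : ℝ) := by exact_mod_cast hP
    exact this
  set R := taylor 1 p - p with hR
  have hRd : R.natDegree ≤ k := natDegree_taylor_sub_le hpd.le 1
  have hRc : 0 < R.coeff k := by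
    rw [hR, coeff_taylor_sub hpd.le]; positivity
  have hRe : ∀ m : ℕ, R.eval (m : ℝ) = polyVal P (m + 1) - polyVal P m := by
    intro m
    rw [hR, eval_sub, taylor_eval, polyVal_eq, polyVal_eq]; push_cast; rfl
  have hmono : ∀ᶠ x : ℝ in Filter.atTop, 0 ≤ (taylor 1 R - R).eval x := by
    rcases Nat.eq_zero_or_pos k with h0 | h0
    · refine Filter.Eventually.of_forall fun x => ?_
      have hRC := eq_C_of_natDegree_le_zero (p := R) (by omega)
      rw [hRC]
      simp
    · obtain ⟨j, hj⟩ : ∃ j, k = j + 1 := ⟨k - 1, by omega⟩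
      rw [hj] at hRd hRc
      refine eventually_eval_nonneg (natDegree_taylor_sub_le hRd 1) ?_
      rw [coeff_taylor_sub hRd]; positivity
  obtain ⟨B₁, hB₁, h1⟩ := abs_eval_le hpd.le
  obtain ⟨B₂, hB₂, h2⟩ := abs_eval_le hRd
  obtain ⟨y, hy⟩ := Filter.eventually_atTop.1
    ((eventually_mul_pow_le_eval hRd hRc).and hmono)
  have hcast : ∀ m : ℕ, ⌈y⌉₊ ≤ m → y ≤ (m : ℝ) := fun m hm =>
    (Nat.le_ceil y).trans (by exact_mod_cast hm)
  have hone : ∀ m : ℕ, 1 ≤ m → (1 : ℝ) ≤ m := fun m hm => by exact_mod_cast hm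
  rw [hk, Nat.add_sub_cancel]
  refine ⟨max B₁ B₂, R.coeff k / 2, ⌈y⌉₊, lt_max_of_lt_left hB₁, by positivity,
    fun m hm => ?_, fun m hm => ?_, fun m hm => ?_, fun m hm => ?_⟩
  · rw [polyVal_eq]
    exact (h1 _ (hone m hm)).trans (mul_le_mul_of_nonneg_right (le_max_left _ _) (by positivity))
  · rw [← hRe]
    exact (h2 _ (hone m hm)).trans (mul_le_mul_of_nonneg_right (le_max_right _ _) (by positivity))
  · rw [← hRe]
    exact (hy _ (hcast m hm)).1
  · have h3 := (hy _ (hcast m hm)).2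
    rw [eval_sub, taylor_eval, sub_nonneg] at h3
    have h4 := hRe (m + 1)
    push_cast at h4
    rw [← h4, ← hRe]
    exact h3

/-- Decay of the exponential sums at small frequencies. -/
lemma norm_expSum_decay {P : ℤ[X]} (hd : 1 ≤ P.natDegree) {B c : ℝ} {x₀ : ℕ} (hc : 0 < c)
    (hB : ∀ m : ℕ, 1 ≤ m →
      |polyVal P (m + 1) - polyVal P m| ≤ B * (m : ℝ) ^ (P.natDegree - 1))
    (hlow : ∀ m : ℕ, x₀ ≤ m →
      c * (m : ℝ) ^ (P.natDegree - 1) ≤ polyVal P (m + 1) - polyVal P m)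
    (hmono : ∀ m : ℕ, x₀ ≤ m →
      polyVal P (m + 1) - polyVal P m ≤ polyVal P (m + 1 + 1) - polyVal P (m + 1))
    {γ : ℝ} (hγ : γ ≠ 0) (hγ1 : |γ| ≤ 1) {t : ℕ}
    (ht : B * |γ| * ((t : ℝ) + 1) ^ (P.natDegree - 1) ≤ 1 / 2) :
    ‖expSum P t γ‖ ≤ (x₀ + 2 + 1 / c) / |γ| ^ (1 / (P.natDegree : ℝ)) := by
  wlog hpos : 0 < γ generalizing γ
  · have h := this (γ := -γ) (neg_ne_zero.2 hγ) (by rwa [abs_neg]) (by rwa [abs_neg])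
      (by rcases lt_or_gt_of_ne hγ with h | h <;> [linarith; exact absurd h hpos])
    rwa [norm_expSum_neg, abs_neg] at h
  rw [abs_of_pos hpos] at hγ1 ht ⊢
  set d := P.natDegree with hdd
  have hd0 : (0 : ℝ) < d := by exact_mod_cast hd
  have hB0 : 0 ≤ B := by
    have := (abs_nonneg _).trans (hB 1 le_rfl)
    simpa using this
  set g := γ ^ (1 / (d : ℝ)) with hg
  have hg0 : 0 < g := Real.rpow_pos_of_pos hpos _
  have hg1 : g ≤ 1 := Real.rpow_le_one hpos.le hγ1 (by positivity)
  have hgd : g ^ d = γ := by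
    rw [hg, ← Real.rpow_natCast, ← Real.rpow_mul hpos.le, one_div_mul_cancel hd0.ne',
      Real.rpow_one]
  have hginv : 1 ≤ 1 / g := by rw [le_div_iff₀ hg0]; linarith
  -- The sum is cut near γ^(-1/d). The first r terms are bounded trivially; afterwards the phase
  -- increments are at least cγ g^(-(d-1)) = cg, and `ht` keeps them below 1/2.
  set r := max x₀ ⌈1 / g⌉₊ with hr
  have hr1 : (r : ℝ) ≤ (x₀ + 2) / g := by
    have h1 : (⌈1 / g⌉₊ : ℝ) < 1 / g + 1 := Nat.ceil_lt_add_one (by positivity)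
    have h2 : (x₀ : ℝ) ≤ x₀ * (1 / g) := le_mul_of_one_le_right (by positivity) hginv
    have h3 : ((x₀ : ℝ) + 2) / g = x₀ * (1 / g) + 2 * (1 / g) := by ring
    have h4 : (0 : ℝ) ≤ x₀ := by positivity
    rw [hr, Nat.cast_max]
    refine max_le ?_ ?_ <;> rw [h3] <;> linarith
  have hr2 : 1 / g ≤ r := (Nat.le_ceil _).trans (by exact_mod_cast le_max_right _ _)
  have hr3 : x₀ ≤ r := le_max_left _ _
  have hsplit : (x₀ + 2 + 1 / c) / g = (x₀ + 2) / g + 1 / (c * g) := by field_simp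
  have hlast : 0 < 1 / (c * g) := by positivity
  rcases le_or_gt t r with h | h
  · have h1 : (t : ℝ) ≤ r := by exact_mod_cast h
    have := norm_expSum_le P t γ
    linarith
  · obtain ⟨L, rfl⟩ := Nat.exists_eq_add_of_lt h
    rw [show r + L + 1 = r + (L + 1) by ring] at ht ⊢
    set L' := L + 1
    rw [expSum_eq, Finset.sum_range_add]
    have h1 := norm_sum_e_le r (fun m => γ * polyVal P (m + 1))
    have h2 : ‖∑ j ∈ Finset.range L', e (γ * polyVal P (r + j + 1))‖ ≤ 1 / (c * g) := by
      have hstep : ∀ j, γ * polyVal P (r + (j + 1) + 1) - γ * polyVal P (r + j + 1) =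
          γ * (polyVal P (r + j + 1 + 1) - polyVal P (r + j + 1)) := fun j => by
        rw [← mul_sub]; rfl
      refine norm_sum_e_le_of_monotone (φ := fun j => γ * polyVal P (r + j + 1))
        (by positivity) (fun j _ => ?_) (fun j hj => ?_) (fun j _ => ?_)
      · simp only [hstep]
        have h3 := hlow (r + j + 1) (by omega)
        have h4 : (1 / g) ^ (d - 1) ≤ ((r + j + 1 : ℕ) : ℝ) ^ (d - 1) := by
          gcongr
          push_cast
          have : (0 : ℝ) ≤ j := by positivity
          linarith
        calc c * g = γ * (c * (1 / g) ^ (d - 1)) := by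
              obtain ⟨k, hk⟩ : ∃ k, d = k + 1 := ⟨d - 1, by omega⟩
              rw [← hgd, hk, Nat.add_sub_cancel, div_pow, one_pow]
              field_simp
              ring
          _ ≤ γ * (polyVal P (r + j + 1 + 1) - polyVal P (r + j + 1)) := by
              gcongr
              exact le_trans (by gcongr) h3
      · simp only [hstep]
        have h3 := (le_abs_self _).trans (hB (r + j + 1) (by omega))
        have h4 : ((r + j + 1 : ℕ) : ℝ) ^ (d - 1) ≤ (((r + L' : ℕ) : ℝ) + 1) ^ (d - 1) := by
          gcongr
          exact_mod_cast (by omega : r + j + 1 ≤ r + L' + 1)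
        calc γ * (polyVal P (r + j + 1 + 1) - polyVal P (r + j + 1))
            ≤ γ * (B * (((r + L' : ℕ) : ℝ) + 1) ^ (d - 1)) := by
              gcongr
              exact h3.trans (by gcongr)
          _ ≤ 1 / 2 := by linarith
      · have h3 := hmono (r + j + 1) (by omega)
        have e1 := hstep j
        have e2 := hstep (j + 1)
        rw [e1, e2]
        exact mul_le_mul_of_nonneg_left h3 hpos.le
    refine (norm_add_le _ _).trans ?_
    rw [hsplit]
    exact add_le_add (h1.trans hr1) h2

/-! ### Means near zero and near a rational point -/

lemma norm_expMean_sub_one_le {P : ℤ[X]} {B : ℝ} (hB0 : 0 ≤ B)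
    (hB : ∀ m : ℕ, 1 ≤ m → |polyVal P m| ≤ B * (m : ℝ) ^ P.natDegree) {t : ℕ} (ht : 1 ≤ t)
    (γ : ℝ) : ‖expMean P t γ - 1‖ ≤ 2 * Real.pi * B * (|γ| * (t : ℝ) ^ P.natDegree) := by
  have ht' : (0 : ℝ) < t := by exact_mod_cast ht
  have htc : (t : ℂ) ≠ 0 := by exact_mod_cast ht'.ne'
  have h1 : expMean P t γ - 1 =
      (∑ m ∈ Finset.range t, (e (γ * polyVal P (m + 1)) - 1)) / t := by
    rw [expMean, expSum_eq, Finset.sum_sub_distrib, sub_div]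
    simp [htc]
  rw [h1, norm_div, Complex.norm_natCast, div_le_iff₀ ht']
  refine (norm_sum_le _ _).trans ?_
  calc ∑ m ∈ Finset.range t, ‖e (γ * polyVal P (m + 1)) - 1‖
      ≤ ∑ m ∈ Finset.range t, 2 * Real.pi * B * (|γ| * (t : ℝ) ^ P.natDegree) := by
        refine Finset.sum_le_sum fun m hm => (norm_e_sub_one_le _).trans ?_
        rw [abs_mul]
        have h2 : |polyVal P (m + 1)| ≤ B * (t : ℝ) ^ P.natDegree := by
          refine (hB (m + 1) (by omega)).trans ?_
          gcongr
          exact_mod_cast Finset.mem_range.1 hm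
        calc 2 * Real.pi * (|γ| * |polyVal P (m + 1)|)
            ≤ 2 * Real.pi * (|γ| * (B * (t : ℝ) ^ P.natDegree)) := by
              have := Real.pi_pos; gcongr
          _ = _ := by ring
    _ = _ := by rw [Finset.sum_const, Finset.card_range, nsmul_eq_mul]; ring

/-- The phase splits as a Q-periodic factor w times e(γP). The partial sums of w - G stay below 2Q,
and e(γP) has total variation at most 2πB|γ|t^d, so summation by parts applies. -/
lemma norm_expMean_sub_mul_le {P : ℤ[X]} (hd : 1 ≤ P.natDegree) {B : ℝ}
    (hB : ∀ m : ℕ, 1 ≤ m →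
      |polyVal P (m + 1) - polyVal P m| ≤ B * (m : ℝ) ^ (P.natDegree - 1))
    (A : ℤ) {Q t : ℕ} (hQ : 1 ≤ Q) (ht : 1 ≤ t) (γ : ℝ) :
    ‖expMean P t (A / Q + γ) - expMean P Q (A / Q) * expMean P t γ‖ ≤
      2 * Q * (1 + 2 * Real.pi * B * (|γ| * (t : ℝ) ^ P.natDegree)) / t := by
  have ht' : (0 : ℝ) < t := by exact_mod_cast ht
  have hB0 : 0 ≤ B := by
    have := (abs_nonneg _).trans (hB 1 le_rfl)
    simpa using this
  have hpi := Real.pi_pos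
  set G := expMean P Q (A / Q) with hG
  set w : ℕ → ℂ := fun m => e ((A / Q : ℝ) * polyVal P (m + 1)) with hw
  have hGw : G = (∑ j ∈ Finset.range Q, w j) / Q := by rw [hG, expMean, expSum_eq]
  have hper : ∀ n, w (Q + n) = w n := fun n => by
    have := e_rational_periodic P A hQ (n + 1)
    simp only [hw, polyVal]
    rw [show ((Q + n + 1 : ℕ) : ℤ) = Q + (n + 1) by push_cast; ring,
      show ((n + 1 : ℕ) : ℤ) = n + 1 by push_cast; rfl]
    exact this
  have h1 : expMean P t (A / Q + γ) - G * expMean P t γ =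
      (∑ m ∈ Finset.range t, (w m - G) * e (γ * polyVal P (m + 1))) / t := by
    rw [expMean, expMean, expSum_eq, expSum_eq, mul_div_assoc', ← sub_div, Finset.mul_sum,
      ← Finset.sum_sub_distrib]
    congr 1
    refine Finset.sum_congr rfl fun m _ => ?_
    rw [add_mul, e_add, sub_mul]
  rw [h1, norm_div, Complex.norm_natCast]
  gcongr
  have h2 := norm_sum_mul_le (v := fun m => w m - G) (u := fun m => e (γ * polyVal P (m + 1)))
    (B := 2 * Q) (fun n => by
      rw [hGw]; exact norm_sum_periodic_sub_mean_le hQ (fun n => (norm_e _).le) hper n)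
    (fun n => (norm_e _).le) t
  refine h2.trans ?_
  gcongr
  calc ∑ m ∈ Finset.range t, ‖e (γ * polyVal P (m + 1 + 1)) - e (γ * polyVal P (m + 1))‖
      ≤ ∑ m ∈ Finset.range t, 2 * Real.pi * (|γ| * (B * (t : ℝ) ^ (P.natDegree - 1))) := by
        refine Finset.sum_le_sum fun m hm => (norm_e_sub_e_le _ _).trans ?_
        rw [← mul_sub, abs_mul]
        have h3 : |polyVal P (m + 1 + 1) - polyVal P (m + 1)| ≤
            B * (t : ℝ) ^ (P.natDegree - 1) := by
          refine (hB (m + 1) (by omega)).trans ?_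
          gcongr
          exact_mod_cast Finset.mem_range.1 hm
        gcongr
    _ = _ := by
        rw [Finset.sum_const, Finset.card_range, nsmul_eq_mul]
        obtain ⟨k, hk⟩ : ∃ k, P.natDegree = k + 1 := ⟨P.natDegree - 1, by omega⟩
        rw [hk, Nat.add_sub_cancel]; ring

/-! ### Complete exponential sums -/

/-- Decay of the complete exponential sums. -/
lemma exists_gauss_bound {P : ℤ[X]} (hd : 1 ≤ P.natDegree) {b : ℕ} (hb : 1 ≤ b)
    (hbP : P.leadingCoeff = b) :
    ∃ C : ℝ, 1 ≤ C ∧ ∀ (A : ℤ) (q : ℕ), 1 ≤ q → IsCoprime A (q : ℤ) →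
      ‖expMean P (b * q) (A / (b * q : ℕ))‖ ≤
        C * (q : ℝ) ^ (-(1 / (2 * (2 ^ (P.natDegree - 1) : ℕ) : ℝ))) := by
  obtain ⟨C, hC, h⟩ := norm_expMean_pow_le P hd (ε := 1 / 4) (by norm_num)
  have hb' : (1 : ℝ) ≤ b := by exact_mod_cast hb
  refine ⟨3 * C * b, by nlinarith, fun A q hq hc => ?_⟩
  set K := 2 ^ (P.natDegree - 1) with hK
  have hK0 : K ≠ 0 := by positivity
  have hK' : (0 : ℝ) < K := by exact_mod_cast Nat.pos_of_ne_zero hK0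
  have hq1 : (1 : ℝ) ≤ q := by exact_mod_cast hq
  have hq0 : (0 : ℝ) < q := by linarith
  set Q := b * q with hQ
  have hQ1 : 1 ≤ Q := Nat.mul_pos hb hq
  have hQr : (Q : ℝ) = b * q := by rw [hQ]; push_cast; rfl
  have hqQ : (q : ℝ) ≤ Q := by rw [hQr]; nlinarith
  have hQ1' : (1 : ℝ) ≤ Q := by linarith
  have hQ0 : (0 : ℝ) < Q := by linarith
  -- The mean over one period equals the mean over Q periods. For d = 1 the length Q would leave
  -- q/N^d = 1/b, without decay; length Q² makes all three terms at most 1/q. With ε = 1/4 the loss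
  -- is only O(q^(1/2)).
  rw [← expMean_rational_mul P A hQ1 hQ1]
  have hNQ : ((Q * Q : ℕ) : ℝ) = Q * Q := by push_cast; rfl
  have hpow : (Q : ℝ) * Q ≤ (((Q * Q : ℕ) : ℝ)) ^ P.natDegree := by
    rw [hNQ]; exact le_self_pow₀ (by nlinarith) (by omega)
  have hmul : (q : ℝ) * q ≤ Q * Q := by gcongr
  -- A/Q need not be reduced, but b_d A/Q is exactly the reduced fraction A/q.
  have hsmall : (P.leadingCoeff : ℝ) * (A / Q) - A / q = 0 := by
    rw [hbP, hQr]; push_cast; field_simp; ring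
  have h1 := h (A / Q) A q (Q * Q) hq hc (by rw [hsmall, abs_zero]; positivity)
    (Nat.mul_pos hQ1 hQ1) (by nlinarith)
  refine le_mul_of_pow_le (K := K) (by positivity) (by nlinarith) hK0 (h1.trans ?_)
  have hB : ((q : ℝ) ^ (-(1 / (2 * (K : ℕ) : ℝ)))) ^ K = (q : ℝ) ^ (1 / 2 : ℝ) * (1 / q) := by
    rw [← Real.rpow_natCast, ← Real.rpow_mul hq0.le, one_div (q : ℝ), ← Real.rpow_neg_one,
      ← Real.rpow_add hq0]
    congr 1; field_simp; norm_num
  have e0 : ((Q * Q : ℕ) : ℝ) ^ (1 / 4 : ℝ) ≤ b * (q : ℝ) ^ (1 / 2 : ℝ) := by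
    rw [hNQ, Real.mul_rpow hQ0.le hQ0.le, ← Real.rpow_add hQ0, hQr,
      Real.mul_rpow (by positivity) hq0.le]
    norm_num
    gcongr
    calc (b : ℝ) ^ (1 / 2 : ℝ) ≤ (b : ℝ) ^ (1 : ℝ) :=
          Real.rpow_le_rpow_of_exponent_le hb' (by norm_num)
      _ = b := Real.rpow_one _
  have e1 : 1 / ((Q * Q : ℕ) : ℝ) ≤ 1 / q := by
    rw [hNQ]; exact one_div_le_one_div_of_le hq0 (by nlinarith)
  have e2 : (q : ℝ) / ((Q * Q : ℕ) : ℝ) ^ P.natDegree ≤ 1 / q := by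
    rw [div_le_div_iff₀ (by positivity) hq0]; linarith
  rw [hB]
  calc C * (((Q * Q : ℕ) : ℝ) ^ (1 / 4 : ℝ) *
        (1 / q + 1 / ((Q * Q : ℕ) : ℝ) + q / ((Q * Q : ℕ) : ℝ) ^ P.natDegree))
      ≤ C * (b * (q : ℝ) ^ (1 / 2 : ℝ) * (1 / q + 1 / q + 1 / q)) := by gcongr
    _ = _ := by ring

/-! ### Difference of the means at a small frequency -/

/-- The estimate for the difference of the means at a small frequency. -/
lemma exists_mean_difference_bound {P : ℤ[X]} (hd : 1 ≤ P.natDegree) (hP : 0 < P.leadingCoeff) :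
    ∃ E C : ℝ, 0 < E ∧ 0 < C ∧ ∀ (γ : ℝ) (n t : ℕ), 2 ^ n ≤ t → t ≤ 2 ^ (n + 1) → |γ| ≤ 1 →
      E * (|γ| * ((2 : ℝ) ^ n) ^ (P.natDegree - 1)) ≤ 1 / 2 →
      ‖expMean P t γ - expMean P (2 ^ n) γ‖ ≤
        C * min ((2 : ℝ) ^ n * |γ| ^ (1 / (P.natDegree : ℝ)))
          (1 / ((2 : ℝ) ^ n * |γ| ^ (1 / (P.natDegree : ℝ)))) := by
  obtain ⟨B, c, x₀, hB, hc, hb1, hb2, hb3, hb4⟩ := exists_growth_bounds hd hP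
  have hpi := Real.pi_pos
  set d := P.natDegree with hdd
  have hd0 : (0 : ℝ) < d := by exact_mod_cast hd
  set C₁ : ℝ := 4 * Real.pi * B * 2 ^ d with hC₁
  set C₂ : ℝ := 2 * (x₀ + 2 + 1 / c) with hC₂
  have hC₁0 : 0 < C₁ := by positivity
  have hC₂0 : 0 < C₂ := by positivity
  -- The 3 comes from t + 1 ≤ 2 · 2^n + 1 ≤ 3 · 2^n; this is what the decay estimate needs to keep
  -- phase increments at most 1/2.
  refine ⟨B * 3 ^ (d - 1), max C₁ C₂, by positivity, lt_max_of_lt_left hC₁0,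
    fun γ n t ht1 ht2 hγ1 hE => ?_⟩
  set T : ℝ := (2 : ℝ) ^ n with hT
  have hT1 : 1 ≤ T := one_le_pow₀ (by norm_num)
  have hT0 : 0 < T := by linarith
  set g := |γ| ^ (1 / (d : ℝ)) with hg
  have hg0 : 0 ≤ g := by positivity
  have hgd : g ^ d = |γ| := by
    rw [hg, ← Real.rpow_natCast, ← Real.rpow_mul (abs_nonneg γ), one_div_mul_cancel hd0.ne',
      Real.rpow_one]
  set Y := T * g with hY
  have hY0 : 0 ≤ Y := by positivity
  have hrange : ∀ t' : ℕ, 2 ^ n ≤ t' → t' ≤ 2 ^ (n + 1) →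
      1 ≤ t' ∧ T ≤ t' ∧ (t' : ℝ) ≤ 2 * T := by
    intro t' h1 h2
    refine ⟨le_trans Nat.one_le_two_pow h1, by rw [hT]; exact_mod_cast h1, ?_⟩
    rw [hT, ← pow_succ']; exact_mod_cast h2
  have h2n : 2 ^ n ≤ 2 ^ (n + 1) := Nat.pow_le_pow_right (by norm_num) (by omega)
  have hone : ∀ t' : ℕ, 2 ^ n ≤ t' → t' ≤ 2 ^ (n + 1) → ‖expMean P t' γ - 1‖ ≤
      C₁ / 2 * Y ^ d := by
    intro t' h1 h2
    obtain ⟨e1, _, e3⟩ := hrange t' h1 h2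
    refine (norm_expMean_sub_one_le hB.le hb1 e1 γ).trans ?_
    calc 2 * Real.pi * B * (|γ| * (t' : ℝ) ^ d) ≤ 2 * Real.pi * B * (|γ| * (2 * T) ^ d) := by
          gcongr
      _ = C₁ / 2 * Y ^ d := by rw [hC₁, hY, mul_pow, mul_pow, hgd]; ring
  have hsmall : ‖expMean P t γ - expMean P (2 ^ n) γ‖ ≤ C₁ * Y ^ d := by
    have h1 := hone t ht1 ht2
    have h2 := hone (2 ^ n) le_rfl h2n
    have h3 : expMean P t γ - expMean P (2 ^ n) γ =
        (expMean P t γ - 1) - (expMean P (2 ^ n) γ - 1) := by ring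
    rw [h3]
    refine (norm_sub_le _ _).trans ?_
    linarith
  have hlarge : γ ≠ 0 → ‖expMean P t γ - expMean P (2 ^ n) γ‖ ≤ C₂ * (1 / Y) := by
    intro hγ
    have hg1 : 0 < g := Real.rpow_pos_of_pos (abs_pos.2 hγ) _
    have h1 : ∀ t' : ℕ, 2 ^ n ≤ t' → t' ≤ 2 ^ (n + 1) → ‖expMean P t' γ‖ ≤
        C₂ / 2 * (1 / Y) := by
      intro t' h1 h2
      obtain ⟨_, e2, e3⟩ := hrange t' h1 h2
      have ht0 : (0 : ℝ) < t' := by linarith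
      have h3 : B * |γ| * ((t' : ℝ) + 1) ^ (d - 1) ≤ 1 / 2 := by
        refine le_trans ?_ hE
        calc B * |γ| * ((t' : ℝ) + 1) ^ (d - 1) ≤ B * |γ| * (3 * T) ^ (d - 1) := by
              gcongr; linarith
          _ = _ := by rw [mul_pow]; ring
      have h4 := norm_expSum_decay hd hc hb2 hb3 hb4 hγ hγ1 h3
      rw [expMean, norm_div, Complex.norm_natCast]
      calc ‖expSum P t' γ‖ / t' ≤ (x₀ + 2 + 1 / c) / g / T := by gcongr
        _ = C₂ / 2 * (1 / Y) := by rw [hC₂, hY]; field_simp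
    have h2 := h1 t ht1 ht2
    have h3 := h1 (2 ^ n) le_rfl h2n
    refine (norm_sub_le _ _).trans ?_
    linarith
  have hmax1 : C₁ ≤ max C₁ C₂ := le_max_left _ _
  have hmax2 : C₂ ≤ max C₁ C₂ := le_max_right _ _
  -- At γ = 0 the convention 1/0 = 0 makes the minimum 0, and the two means agree.
  rcases eq_or_ne γ 0 with h0 | h0
  · have hYz : Y = 0 := by
      rw [hY, hg, h0, abs_zero, Real.zero_rpow (by positivity), mul_zero]
    rw [hYz] at hsmall ⊢
    rw [zero_pow (by omega)] at hsmall
    simpa using hsmall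
  · have hYpos : 0 < Y := mul_pos hT0 (Real.rpow_pos_of_pos (abs_pos.2 h0) _)
    rcases le_or_gt Y 1 with h1 | h1
    · have h2 : Y ≤ 1 / Y := by rw [le_div_iff₀ hYpos]; nlinarith
      rw [min_eq_left h2]
      refine hsmall.trans (mul_le_mul hmax1 ?_ (by positivity) (by positivity))
      exact pow_le_of_le_one hY0 h1 (by omega)
    · have h2 : 1 / Y ≤ Y := by rw [div_le_iff₀ hYpos]; nlinarith
      rw [min_eq_right h2]
      exact (hlarge h0).trans (mul_le_mul_of_nonneg_right hmax2 (by positivity))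

/-- Replaces |γ| by the arc distance b|γ| inside the minimum, at the cost of a factor b. -/
lemma min_scale_le {x y b : ℝ} (hb : 1 ≤ b) (hx : 0 ≤ x) (hxy : x ≤ y) (hyx : y ≤ b * x) :
    min x (1 / x) ≤ b * min y (1 / y) := by
  have hy : 0 ≤ y := hx.trans hxy
  rcases hx.eq_or_lt with h | h
  · rw [← h] at hyx ⊢
    simp only [div_zero, min_self]
    positivity
  · have hy' : 0 < y := h.trans_le hxy
    rw [mul_min_of_nonneg _ _ (by linarith)]
    refine min_le_min (by nlinarith) ?_
    rw [mul_one_div, div_le_div_iff₀ h hy']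
    linarith

/-! ### Major arcs -/

set_option maxHeartbeats 1000000 in
/-- The major arc estimate. -/
lemma exists_major_bound {P : ℤ[X]} (hd : 1 ≤ P.natDegree) (hP : 0 < P.leadingCoeff) {δ : ℝ}
    (hδ : 0 < δ) (hδ1 : δ < 1 / 4) :
    ∃ ν : ℝ, 0 < ν ∧ ∃ C : ℝ, 0 < C ∧ ∀ n t : ℕ, 2 ^ n ≤ t → t ≤ 2 ^ (n + 1) →
      ∀ s a q : ℕ, (s : ℝ) ≤ (n : ℝ) * δ → (a, q) ∈ ratShell s → ∀ α ∈ majorArc P δ n a q,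
        ‖expMean P t α - expMean P (2 ^ n) α‖ ≤ C * (2 : ℝ) ^ (-(ν * (s : ℝ))) *
          (min ((2 : ℝ) ^ (n : ℝ) * arcDist P a q α ^ (1 / (P.natDegree : ℝ)))
            (1 / ((2 : ℝ) ^ (n : ℝ) * arcDist P a q α ^ (1 / (P.natDegree : ℝ)))) +
            (2 : ℝ) ^ (-((n : ℝ) / 2))) := by
  obtain ⟨B, c, x₀, hB, hc, hb1, hb2, hb3, hb4⟩ := exists_growth_bounds hd hP
  obtain ⟨E, C₁, hE, hC₁, hdiff⟩ := exists_mean_difference_bound hd hP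
  obtain ⟨b, hbP⟩ := Int.eq_ofNat_of_zero_le hP.le
  have hb : 1 ≤ b := by omega
  obtain ⟨C₂, hC₂, hgauss⟩ := exists_gauss_bound hd hb hbP
  have hpi := Real.pi_pos
  set d := P.natDegree with hdd
  have hd0 : (0 : ℝ) < d := by exact_mod_cast hd
  have hd1 : (1 : ℝ) ≤ d := by exact_mod_cast hd
  have hb' : (1 : ℝ) ≤ b := by exact_mod_cast hb
  set K := 2 ^ (d - 1) with hK
  have hK' : (0 : ℝ) < K := by rw [hK]; positivity
  -- The first entry is the decay exponent of the complete sums. The second gives νs ≤ n(1/2 - 2δ)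
  -- for s ≤ nδ, so that the error 2^(-n(1-2δ)) is at most 2^(-νs) 2^(-n/2).
  set ν := min (1 / (2 * (K : ℝ))) ((1 / 2 - 2 * δ) / δ) with hν
  have hν0 : 0 < ν := lt_min (by positivity) (div_pos (by linarith) hδ)
  set C₃ : ℝ := 4 * b * (1 + 2 * Real.pi * B * 2 ^ d) with hC₃
  have hC₃0 : 0 < C₃ := by positivity
  refine ⟨ν, hν0, C₂ * C₁ * b + 2 * C₃ + 4 * E, by positivity,
    fun n t ht1 ht2 s a q hs haq α hα => ?_⟩
  obtain ⟨haq1, haq2, hq1, hq2⟩ := haq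
  simp only at haq1 haq2 hq1 hq2
  obtain ⟨z, hz⟩ := arcDist_eq P haq1 α
  set D := arcDist P a q α with hD
  have hDlt : D < (2 : ℝ) ^ (-((n : ℝ) * ((d : ℝ) - δ))) := hα
  have hD0 : 0 ≤ D := by rw [hz]; exact abs_nonneg _
  have hqpos : 1 ≤ q := by omega
  have hq0 : (0 : ℝ) < q := by exact_mod_cast hqpos
  have hn0 : (0 : ℝ) ≤ n := by positivity
  have hs0 : (0 : ℝ) ≤ s := by positivity
  have hmono : ∀ {x y : ℝ}, x ≤ y → (2 : ℝ) ^ x ≤ 2 ^ y := fun h =>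
    Real.rpow_le_rpow_of_exponent_le (by norm_num) h
  set β := (P.leadingCoeff : ℝ) * α - z - a / q with hβ
  set γ := β / b with hγ
  set Q := b * q with hQ
  set A : ℤ := a + z * q with hA
  have hQ1 : 1 ≤ Q := Nat.mul_pos hb hqpos
  have hαeq : α = (A : ℝ) / Q + γ := by
    rw [hγ, hβ, hA, hQ, hbP]; push_cast; field_simp; ring
  have hAq : IsCoprime A (q : ℤ) :=
    IsCoprime.add_mul_right_left_iff.2 (Nat.isCoprime_iff_coprime.2 haq2)
  have hγD : |γ| = D / b := by rw [hγ, abs_div, hz, abs_of_pos (by linarith : (0 : ℝ) < b)]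
  have hγle : |γ| ≤ D := by rw [hγD]; exact div_le_self hD0 hb'
  set T : ℝ := (2 : ℝ) ^ n with hT
  have hTr : (2 : ℝ) ^ (n : ℝ) = T := Real.rpow_natCast 2 n
  have hT0 : 0 < T := by positivity
  have hTpow : ∀ j : ℕ, T ^ j = (2 : ℝ) ^ ((n : ℝ) * j) := fun j => by
    rw [Real.rpow_mul (by norm_num), hTr, Real.rpow_natCast]
  set G := expMean P Q (A / Q) with hG
  have hGb : ‖G‖ ≤ C₂ * (2 : ℝ) ^ (-(ν * s)) := by
    refine (hgauss A q hqpos hAq).trans ?_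
    refine mul_le_mul_of_nonneg_left ?_ (by linarith)
    have h1 : (2 : ℝ) ^ (s : ℝ) ≤ q := by rw [Real.rpow_natCast]; exact_mod_cast hq1
    calc (q : ℝ) ^ (-(1 / (2 * (K : ℕ) : ℝ))) ≤ ((2 : ℝ) ^ (s : ℝ)) ^ (-(1 / (2 * (K : ℝ)))) :=
          Real.rpow_le_rpow_of_nonpos (by positivity) h1 (by
            have : 0 ≤ 1 / (2 * (K : ℝ)) := by positivity
            linarith)
      _ = (2 : ℝ) ^ (-(1 / (2 * (K : ℝ)) * s)) := by
          rw [← Real.rpow_mul (by norm_num)]; congr 1; ring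
      _ ≤ _ := hmono (neg_le_neg (mul_le_mul_of_nonneg_right (min_le_left _ _) hs0))
  set W : ℝ := (2 : ℝ) ^ (-((n : ℝ) * (1 - 2 * δ))) with hW
  set F : ℝ := (2 : ℝ) ^ (-(ν * s)) with hF
  set H : ℝ := (2 : ℝ) ^ (-((n : ℝ) / 2)) with hH
  have hF0 : 0 < F := by positivity
  have hH0 : 0 < H := by positivity
  have hWF : W ≤ F * H := by
    rw [hF, hH, ← Real.rpow_add (by norm_num)]
    refine hmono ?_
    have h1 : ν * s ≤ (1 / 2 - 2 * δ) / δ * (n * δ) :=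
      mul_le_mul (min_le_right _ _) hs hs0 (div_nonneg (by linarith) hδ.le)
    have h2 : (1 / 2 - 2 * δ) / δ * (n * δ) = n * (1 / 2 - 2 * δ) := by field_simp
    nlinarith
  set X := T * D ^ (1 / (d : ℝ)) with hX
  set m := min X (1 / X) with hm
  have hX0 : 0 ≤ X := by positivity
  have hm0 : 0 ≤ m := le_min hX0 (by positivity)
  rw [hTr]
  by_cases hcase : E * (|γ| * T ^ (d - 1)) ≤ 1 / 2
  · have hγ1 : |γ| ≤ 1 := by
      refine hγle.trans (hDlt.le.trans (Real.rpow_le_one_of_one_le_of_nonpos (by norm_num) ?_))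
      nlinarith
    have h1 := hdiff γ n t ht1 ht2 hγ1 hcase
    have h2 : min (T * |γ| ^ (1 / (d : ℝ))) (1 / (T * |γ| ^ (1 / (d : ℝ)))) ≤ b * m := by
      have hg : |γ| ^ (1 / (d : ℝ)) ≤ D ^ (1 / (d : ℝ)) := by gcongr
      refine min_scale_le hb' (by positivity) (mul_le_mul_of_nonneg_left hg hT0.le) ?_
      have h3 : D = b * |γ| := by rw [hγD]; field_simp
      have h4 : (b : ℝ) ^ (1 / (d : ℝ)) ≤ b := by
        calc (b : ℝ) ^ (1 / (d : ℝ)) ≤ (b : ℝ) ^ (1 : ℝ) :=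
              Real.rpow_le_rpow_of_exponent_le hb' ((div_le_one hd0).2 hd1)
          _ = b := Real.rpow_one _
      have h5 : D ^ (1 / (d : ℝ)) ≤ b * |γ| ^ (1 / (d : ℝ)) := by
        rw [h3, Real.mul_rpow (by positivity) (abs_nonneg _)]
        gcongr
      calc X ≤ T * (b * |γ| ^ (1 / (d : ℝ))) := by rw [hX]; gcongr
        _ = _ := by ring
    -- Both Q and 1 + |γ|t^d are O(2^(nδ)); dividing their product by t gives 2^(-n(1-2δ)) up to a
    -- constant.
    have herr : ∀ t' : ℕ, 2 ^ n ≤ t' → t' ≤ 2 ^ (n + 1) →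
        ‖expMean P t' α - G * expMean P t' γ‖ ≤ C₃ * W := by
      intro t' h1 h2
      have e1 : 1 ≤ t' := le_trans Nat.one_le_two_pow h1
      have e2 : T ≤ t' := by rw [hT]; exact_mod_cast h1
      have e3 : (t' : ℝ) ≤ 2 * T := by rw [hT, ← pow_succ']; exact_mod_cast h2
      have h3 := norm_expMean_sub_mul_le hd hb2 A hQ1 e1 γ
      rw [← hαeq, ← hG] at h3
      refine h3.trans ?_
      set V : ℝ := (2 : ℝ) ^ ((n : ℝ) * δ) with hV
      have hV1 : 1 ≤ V := Real.one_le_rpow (by norm_num) (by positivity)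
      have e4 : (Q : ℝ) ≤ 2 * b * V := by
        have e5 : (q : ℝ) ≤ 2 * 2 ^ (s : ℝ) := by
          rw [Real.rpow_natCast, ← pow_succ']; exact_mod_cast hq2.le
        have e6 : (2 : ℝ) ^ (s : ℝ) ≤ V := hmono hs
        rw [hQ]; push_cast
        nlinarith
      have e5 : |γ| * (t' : ℝ) ^ d ≤ 2 ^ d * V := by
        calc |γ| * (t' : ℝ) ^ d ≤ (2 : ℝ) ^ (-((n : ℝ) * ((d : ℝ) - δ))) * (2 * T) ^ d := by
              gcongr
              exact hγle.trans hDlt.le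
          _ = 2 ^ d * V := by
              rw [mul_pow, hTpow, mul_left_comm, ← Real.rpow_add (by norm_num)]
              congr 2; ring
      have e6 : V * V / T = W := by
        rw [← hTr, hV, hW, ← Real.rpow_add (by norm_num), ← Real.rpow_sub (by norm_num)]
        congr 1; ring
      calc 2 * (Q : ℝ) * (1 + 2 * Real.pi * B * (|γ| * (t' : ℝ) ^ d)) / t'
          ≤ 2 * (2 * b * V) * (V + 2 * Real.pi * B * (2 ^ d * V)) / T := by gcongr
        _ = C₃ * (V * V / T) := by rw [hC₃]; ring
        _ = C₃ * W := by rw [e6]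
    have h2n : 2 ^ n ≤ 2 ^ (n + 1) := Nat.pow_le_pow_right (by norm_num) (by omega)
    have r1 := herr t ht1 ht2
    have r2 := herr (2 ^ n) le_rfl h2n
    have hdec : expMean P t α - expMean P (2 ^ n) α =
        (expMean P t α - G * expMean P t γ) -
        (expMean P (2 ^ n) α - G * expMean P (2 ^ n) γ) +
        G * (expMean P t γ - expMean P (2 ^ n) γ) := by ring
    rw [hdec]
    have r3 := norm_add_le ((expMean P t α - G * expMean P t γ) -
        (expMean P (2 ^ n) α - G * expMean P (2 ^ n) γ))
        (G * (expMean P t γ - expMean P (2 ^ n) γ))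
    have r4 := norm_sub_le (expMean P t α - G * expMean P t γ)
        (expMean P (2 ^ n) α - G * expMean P (2 ^ n) γ)
    have r5 : ‖G * (expMean P t γ - expMean P (2 ^ n) γ)‖ ≤ C₂ * F * (C₁ * (b * m)) := by
      rw [norm_mul]
      exact mul_le_mul hGb (h1.trans (mul_le_mul_of_nonneg_left h2 hC₁.le)) (norm_nonneg _)
        (by positivity)
    have r6 : C₃ * W ≤ C₃ * (F * H) := by gcongr
    have r7 : 0 ≤ (2 * C₃ + 4 * E) * F * m := by positivity
    have r8 : 0 ≤ (C₂ * C₁ * b + 4 * E) * F * H := by positivity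
    calc _ ≤ C₂ * F * (C₁ * (b * m)) + 2 * (C₃ * (F * H)) := by linarith
      _ ≤ _ := by linarith
  -- Here W is bounded below, so n is bounded in terms of P and δ. The trivial bound 2 ≤ 4EW
  -- suffices, whence the summand 4E in the constant.
  · have h1 : 1 ≤ 2 * E * W := by
      have h2 : |γ| * T ^ (d - 1) ≤ W := by
        calc |γ| * T ^ (d - 1) ≤ (2 : ℝ) ^ (-((n : ℝ) * ((d : ℝ) - δ))) * T ^ (d - 1) := by
              gcongr
              exact hγle.trans hDlt.le
          _ = (2 : ℝ) ^ (-((n : ℝ) * (1 - δ))) := by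
              rw [hTpow, ← Real.rpow_add (by norm_num), Nat.cast_sub hd]
              congr 1; push_cast; ring
          _ ≤ W := hmono (by nlinarith)
      have h3 : E * (|γ| * T ^ (d - 1)) ≤ E * W := by gcongr
      push Not at hcase
      linarith
    have h2 : ‖expMean P t α - expMean P (2 ^ n) α‖ ≤ 2 := by
      refine (norm_sub_le _ _).trans ?_
      linarith [norm_expMean_le_one P t α, norm_expMean_le_one P (2 ^ n) α]
    have h3 : E * W ≤ E * (F * H) := by gcongr
    have r7 : 0 ≤ (C₂ * C₁ * b + 2 * C₃ + 4 * E) * F * m := by positivity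
    have r8 : 0 ≤ (C₂ * C₁ * b + 2 * C₃) * F * H := by positivity
    linarith

end PolyMeans

/-! ### Assembly of the three estimates -/

theorem mainTheorem6 :
    ∃ A : ℝ, 0 < A ∧
      ∀ P : ℤ[X], 1 ≤ P.natDegree → 0 < P.leadingCoeff →
      ∀ δ : ℝ, 0 < δ → δ < 1 / 4 →
      ∃ ν : ℝ, 0 < ν ∧ ∃ C : ℝ, 0 < C ∧
      ∀ n t : ℕ, 2 ^ n ≤ t → t ≤ 2 ^ (n + 1) →
        (∀ α : ℝ,
          PolyMeans.fourierZ (PolyMeans.kernelC P n t - PolyMeans.kernelC P n (t + 1)) α =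
            PolyMeans.fourierZ (PolyMeans.kernelK P t - PolyMeans.kernelK P (t + 1)) α ∧
          ‖PolyMeans.fourierZ (PolyMeans.kernelK P t - PolyMeans.kernelK P (t + 1)) α‖
            ≤ A * (2 : ℝ) ^ (-(n : ℝ))) ∧
        (∀ α ∈ PolyMeans.minorArcs P δ n,
          ‖PolyMeans.fourierZ (PolyMeans.kernelC P n t) α‖ ≤ C * (2 : ℝ) ^ (-((n : ℝ) * ν))) ∧
        (∀ s a q : ℕ, (s : ℝ) ≤ (n : ℝ) * δ → (a, q) ∈ PolyMeans.ratShell s →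
          ∀ α ∈ PolyMeans.majorArc P δ n a q,
            ‖PolyMeans.fourierZ (PolyMeans.kernelC P n t) α‖ ≤
              C * (2 : ℝ) ^ (-(ν * (s : ℝ))) *
                (min ((2 : ℝ) ^ (n : ℝ) *
                        PolyMeans.arcDist P a q α ^ (1 / (P.natDegree : ℝ)))
                    (1 / ((2 : ℝ) ^ (n : ℝ) *
                        PolyMeans.arcDist P a q α ^ (1 / (P.natDegree : ℝ)))) +
                  (2 : ℝ) ^ (-((n : ℝ) / 2)))) := by
  refine ⟨2, two_pos, fun P hd hP δ hδ hδ1 => ?_⟩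
  obtain ⟨ν₁, hν₁, C₁, hC₁, hminor⟩ := PolyMeans.exists_minor_bound hd hδ (by linarith)
  obtain ⟨ν₂, hν₂, C₂, hC₂, hmajor⟩ := PolyMeans.exists_major_bound hd hP hδ hδ1
  have hmono : ∀ {x y : ℝ}, x ≤ y → (2 : ℝ) ^ x ≤ 2 ^ y := fun h =>
    Real.rpow_le_rpow_of_exponent_le (by norm_num) h
  refine ⟨min ν₁ ν₂, lt_min hν₁ hν₂, max (2 * C₁) C₂, lt_max_of_lt_right hC₂,
    fun n t ht1 ht2 => ⟨fun α => ⟨?_, ?_⟩, fun α hα => ?_, fun s a q hs haq α hα => ?_⟩⟩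
  · simp only [PolyMeans.kernelC, sub_sub_sub_cancel_right]
  · have ht : 1 ≤ t := le_trans Nat.one_le_two_pow ht1
    rw [PolyMeans.fourierZ_sub, PolyMeans.fourierZ_kernelK, PolyMeans.fourierZ_kernelK,
      ← map_sub, Complex.norm_conj, Real.rpow_neg (by norm_num), Real.rpow_natCast,
      ← div_eq_mul_inv]
    refine (PolyMeans.norm_expMean_sub_succ_le P ht α).trans ?_
    gcongr
    exact_mod_cast ht1
  · rw [PolyMeans.norm_fourierZ_kernelC]
    have h1 := hminor n t ht1 ht2 α hα
    -- The reference length 2^n is itself admissible at scale n, so both means are small and no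
    -- cancellation is used.
    have h2 := hminor n (2 ^ n) le_rfl (Nat.pow_le_pow_right (by norm_num) (by omega)) α hα
    calc _ ≤ 2 * C₁ * (2 : ℝ) ^ (-((n : ℝ) * ν₁)) := by
          refine (norm_sub_le _ _).trans ?_
          linarith
      _ ≤ _ := by
          refine mul_le_mul (le_max_left _ _) (hmono (neg_le_neg ?_)) (by positivity)
            (le_max_of_le_right hC₂.le)
          exact mul_le_mul_of_nonneg_left (min_le_left _ _) (by positivity)
  · rw [PolyMeans.norm_fourierZ_kernelC]
    refine (hmajor n t ht1 ht2 s a q hs haq α hα).trans ?_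
    have hD : 0 ≤ PolyMeans.arcDist P a q α := by
      unfold PolyMeans.arcDist; split_ifs <;> exact abs_nonneg _
    refine mul_le_mul_of_nonneg_right ?_ (add_nonneg (le_min ?_ ?_) ?_)
    · refine mul_le_mul (le_max_right _ _) (hmono (neg_le_neg ?_)) (by positivity)
        (le_max_of_le_right hC₂.le)
      exact mul_le_mul_of_nonneg_right (min_le_right _ _) (by positivity)
    all_goals positivity
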